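/- Let $V_1,\dots,V_d$ be $C^\infty$ vector fields on $\mathbb{R}^n$ whose derivatives of every order $\ge 1$ are bounded (the fields themselves may grow linearly). Set $\Sigma_1=\{V_i : 1\le i\le d\}$ and $\Sigma_{k+1}=\{[V_i,W] : 1\le i\le d,\ W\in\Sigma_k\}$ for $k \ge 1$, and assume the strong Hörmander condition everywhere: for every $y\in\mathbb{R}^n$ the vectors $W(y)$, $W\in\bigcup_{k\ge1}\Sigma_k$, span $\mathbb{R}^n$. Let $\mathcal{W}=C_0([0,1],\mathbb{R}^d)$ be the space of continuous paths starting at $0$, with the sup-norm, and let $\mathcal{H}\subset\mathcal{W}$ be the Cameron–Martin space of the paths $h=\int_0^{\cdot}\dot h_s\,ds$ with $\dot h\in L^2([0,1],\mathbb{R}^d)$, with $\langle h,k\rangle_{\mathcal H}=\int_0^1\langle\dot h_s,\dot k_s\rangle\,ds$. For $h\in\mathcal{H}$ and $x\in\mathbb{R}^n$ let $\phi_t(h)=\phi(t,x,h)$, $0 \le t\le 1$, be the unique solution of the (driftless) skeleton equation $$d\phi_t=\sum_{i=1}^d V_i(\phi_t)\,dh^i_t,\qquad \phi_0=x .$$ The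 map $\phi_1 = \phi(1,x,\cdot):\mathcal{H}\to\mathbb{R}^n$ is Fréchet-$C^1$, and its deterministic Malliavin covariance matrix at $h$ is the $n\times n$ matrix $$\sigma_{\phi_1}(h)=\bigl(\langle D\phi_1^i(h),D\phi_1^j(h)\rangle_{\mathcal{H}^*}\bigr)_{1\le i,j\le n}.$$ For $x,x'\in\mathbb{R}^n$ put $\mathcal{K}^{x,x'}=\{h\in\mathcal{H} : \phi(1,x,h)=x'\}$. Then for all $x,x'\in\mathbb{R}^n$, all $h\in\mathcal{K}^{x,x'}$ and all $\varepsilon>0$, there exists $h^\varepsilon\in\mathcal{K}^{x,x'}$ such that (i) $\|h-h^\varepsilon\|_{\mathcal{H}}<\varepsilon$ and $\sigma_{\phi_1}(h^\varepsilon)$ is non-degenerate, i.e. $\det\sigma_{\phi_1}(h^\varepsilon)\neq0$; and moreover (ii) the functional $\langle h^\varepsilon,\cdot\rangle_{\mathcal H}$ on $\mathcal{H}$ extends to a continuous linear functional on $\mathcal{W}$. -/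

import Mathlib

open MeasureTheory Set
open scoped ContDiff InnerProductSpace

/-- The subspace of the continuous paths `[0,1] → ℝᵈ` that start at `0`. -/
def wienerSubmodule (d : ℕ) : Submodule ℝ C(unitInterval, EuclideanSpace ℝ (Fin d)) where
  carrier := {w | w 0 = 0}
  add_mem' := by
    intro a b ha hb
    simp only [mem_ofPred_eq] at ha hb
    simp [ha, hb]
  zero_mem' := by simp
  smul_mem' := by
    intro c a ha
    simp only [mem_ofPred_eq] at ha
    simp [ha]

/-- The classical Wiener space `C₀([0,1], ℝᵈ)` of continuous paths starting at `0`. -/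
def WienerSpace (d : ℕ) : Type := wienerSubmodule d

namespace WienerSpace

/-- The sup-norm, inherited from `C([0,1], ℝᵈ)`. -/
noncomputable instance (d : ℕ) : NormedAddCommGroup (WienerSpace d) :=
  inferInstanceAs (NormedAddCommGroup (wienerSubmodule d))

noncomputable instance (d : ℕ) : NormedSpace ℝ (WienerSpace d) :=
  inferInstanceAs (NormedSpace ℝ (wienerSubmodule d))

instance (d : ℕ) : CoeOut (WienerSpace d) C(unitInterval, EuclideanSpace ℝ (Fin d)) :=
  ⟨Subtype.val⟩

end WienerSpace

/-- The Hilbert space `L²([0,1], ℝᵈ)`. -/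
abbrev VelocitySpace (d : ℕ) : Type :=
  Lp (EuclideanSpace ℝ (Fin d)) 2 ((volume : Measure ℝ).restrict (Icc (0 : ℝ) 1))

theorem VelocitySpace.intervalIntegrable {d : ℕ} (f : VelocitySpace d) :
    IntervalIntegrable (fun s => f s) volume 0 1 := by
  rw [intervalIntegrable_iff_integrableOn_Icc_of_le zero_le_one]
  exact (Lp.memLp f).integrable (by norm_num)

theorem VelocitySpace.intervalIntegrable_left {d : ℕ} (f : VelocitySpace d) (t : unitInterval) :
    IntervalIntegrable (fun s => f s) volume 0 (t : ℝ) := by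
  refine f.intervalIntegrable.mono_set ?_
  rw [uIcc_of_le t.2.1, uIcc_of_le zero_le_one]
  exact Icc_subset_Icc_right t.2.2

theorem VelocitySpace.integral_congr {d : ℕ} {f g : ℝ → EuclideanSpace ℝ (Fin d)}
    (h : f =ᵐ[(volume : Measure ℝ).restrict (Icc (0 : ℝ) 1)] g) (t : unitInterval) :
    ∫ s in (0 : ℝ)..(t : ℝ), f s = ∫ s in (0 : ℝ)..(t : ℝ), g s := by
  rw [intervalIntegral.integral_of_le t.2.1, intervalIntegral.integral_of_le t.2.1]
  refine setIntegral_congr_ae₀ measurableSet_Ioc.nullMeasurableSet ?_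
  rw [Filter.EventuallyEq, ae_restrict_iff' measurableSet_Icc] at h
  filter_upwards [h] with s hs hst
  exact hs ⟨hst.1.le, hst.2.trans t.2.2⟩

/-- The primitive `t ↦ ∫₀ᵗ f(s) ds` of `f ∈ L²([0,1], ℝᵈ)`, as a continuous path. -/
noncomputable def primitivePath (d : ℕ) :
    VelocitySpace d →ₗ[ℝ] C(unitInterval, EuclideanSpace ℝ (Fin d)) where
  toFun f :=
    ⟨fun t => ∫ s in (0 : ℝ)..(t : ℝ), f s, by
        have h := intervalIntegral.continuousOn_primitive_interval
          (f := fun s => f s) (μ := volume) (a := 0) (b := 1)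
          (by rw [uIcc_of_le zero_le_one]
              exact (Lp.memLp f).integrable (by norm_num))
        rw [uIcc_of_le zero_le_one] at h
        exact continuousOn_iff_continuous_domRestrict.mp h⟩
  map_add' f g := by
    refine ContinuousMap.ext fun t => ?_
    change (∫ s in (0 : ℝ)..(t : ℝ), (f + g : VelocitySpace d) s) =
      (∫ s in (0 : ℝ)..(t : ℝ), f s) + ∫ s in (0 : ℝ)..(t : ℝ), g s
    rw [← intervalIntegral.integral_add (f.intervalIntegrable_left t) (g.intervalIntegrable_left t)]
    exact VelocitySpace.integral_congr (Lp.coeFn_add f g) t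
  map_smul' c f := by
    refine ContinuousMap.ext fun t => ?_
    change (∫ s in (0 : ℝ)..(t : ℝ), (c • f : VelocitySpace d) s) =
      c • ∫ s in (0 : ℝ)..(t : ℝ), f s
    rw [← intervalIntegral.integral_smul]
    exact VelocitySpace.integral_congr (Lp.coeFn_smul c f) t

theorem primitivePath_apply {d : ℕ} (f : VelocitySpace d) (t : unitInterval) :
    primitivePath d f t =
      ∫ s in (0 : ℝ)..(t : ℝ), f s := rfl

theorem primitivePath_injective (d : ℕ) : Function.Injective (primitivePath d) := by
  rw [← LinearMap.ker_eq_bot, LinearMap.ker_eq_bot']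
  intro f hf
  have h0 : ∀ t ∈ Icc (0 : ℝ) 1, ∫ s in (0 : ℝ)..t, f s = 0 := by
    intro t ht
    rw [← primitivePath_apply f ⟨t, ht⟩, hf]
    rfl
  rw [Lp.eq_zero_iff_ae_eq_zero, Filter.EventuallyEq,
    ae_restrict_iff' measurableSet_Icc]
  filter_upwards [f.intervalIntegrable.ae_hasDerivAt_integral,
    (Ioo_ae_eq_Icc (a := (0 : ℝ)) (b := 1) (μ := volume)).mem_iff] with x hx hiff hxI
  have hx01 := hiff.mpr hxI
  rw [uIcc_of_le zero_le_one] at hx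
  have hd := hx ⟨hx01.1.le, hx01.2.le⟩ 0 ⟨le_rfl, zero_le_one⟩
  have hz : HasDerivAt (fun x => ∫ s in (0 : ℝ)..x, f s) 0 x := by
    refine (hasDerivAt_const x (0 : EuclideanSpace ℝ (Fin d))).congr_of_eventuallyEq ?_
    filter_upwards [Ioo_mem_nhds hx01.1 hx01.2] with y hy
    exact h0 y ⟨hy.1.le, hy.2.le⟩
  exact hd.unique hz

/-- The Cameron–Martin space `ℋ`: the paths of the form `h = ∫₀^· ḣ_s ds` with
`ḣ ∈ L²([0,1], ℝᵈ)`. -/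
def CameronMartin (d : ℕ) : Type := LinearMap.range (primitivePath d)

namespace CameronMartin

noncomputable instance (d : ℕ) : AddCommGroup (CameronMartin d) :=
  inferInstanceAs (AddCommGroup (LinearMap.range (primitivePath d)))

noncomputable instance (d : ℕ) : Module ℝ (CameronMartin d) :=
  inferInstanceAs (Module ℝ (LinearMap.range (primitivePath d)))

/-- The inclusion of the Cameron–Martin space in Wiener space. -/
noncomputable def toWiener (d : ℕ) : CameronMartin d →ₗ[ℝ] WienerSpace d where
  toFun h := ⟨h.1, by
    obtain ⟨_, f, rfl⟩ := h
    change (∫ s in (0 : ℝ)..((0 : unitInterval) : ℝ), f s) = 0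
    simp⟩
  map_add' _ _ := rfl
  map_smul' _ _ := rfl

/-- The derivative `h ↦ ḣ`, as a linear bijection onto `L²([0,1], ℝᵈ)`. -/
noncomputable def velocity (d : ℕ) : CameronMartin d ≃ₗ[ℝ] VelocitySpace d :=
  (LinearEquiv.ofInjective (primitivePath d) (primitivePath_injective d)).symm

theorem toWiener_apply {d : ℕ} (h : CameronMartin d) (t : unitInterval) :
    (toWiener d h : C(unitInterval, EuclideanSpace ℝ (Fin d))) t =
      ∫ s in (0 : ℝ)..(t : ℝ), velocity d h s := by
  rw [← primitivePath_apply]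
  have : primitivePath d (velocity d h) =
      (toWiener d h : C(unitInterval, EuclideanSpace ℝ (Fin d))) :=
    congrArg Subtype.val ((velocity d).symm_apply_apply h)
  rw [this]

/-- The norm `‖h‖_ℋ = ‖ḣ‖_{L²}`. -/
noncomputable instance (d : ℕ) : NormedAddCommGroup (CameronMartin d) :=
  NormedAddCommGroup.induced (CameronMartin d) (VelocitySpace d) (velocity d)
    (velocity d).injective

/-- The inner product `⟪h, k⟫_ℋ = ⟪ḣ, k̇⟫_{L²}`. -/
noncomputable instance (d : ℕ) : InnerProductSpace ℝ (CameronMartin d) where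
  norm_smul_le c h := by
    change ‖velocity d (c • h)‖ ≤ ‖c‖ * ‖velocity d h‖
    rw [map_smul, norm_smul]
  inner h k := ⟪velocity d h, velocity d k⟫_ℝ
  norm_sq_eq_re_inner h := by
    change ‖velocity d h‖ ^ 2 = _
    exact norm_sq_eq_re_inner (𝕜 := ℝ) (velocity d h)
  conj_inner_symm h k := by exact inner_conj_symm _ _
  add_left h k l := by
    change ⟪velocity d (h + k), velocity d l⟫_ℝ = _
    rw [map_add, inner_add_left]
  smul_left h k c := by
    change ⟪velocity d (c • h), velocity d k⟫_ℝ = _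
    rw [map_smul, inner_smul_left]

/-- `h ↦ ḣ` is an isometry of `ℋ` onto `L²([0,1], ℝᵈ)`. -/
noncomputable def velocityIsometry (d : ℕ) : CameronMartin d ≃ₗᵢ[ℝ] VelocitySpace d where
  toLinearEquiv := velocity d
  norm_map' _ := rfl

instance (d : ℕ) : CompleteSpace (CameronMartin d) :=
  (completeSpace_congr (e := (velocityIsometry d).toEquiv)
    (velocityIsometry d).isometry.isUniformEmbedding).mpr inferInstance

end CameronMartin

section Skeleton

variable {n d : ℕ}

/-- The vector fields `V₁, …, V_d` are smooth with bounded derivatives of all orders `≥ 1`. -/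
def SmoothBoundedDerivatives
    (V : Fin d → EuclideanSpace ℝ (Fin n) → EuclideanSpace ℝ (Fin n)) : Prop :=
  ∀ i, ContDiff ℝ ∞ (V i) ∧
    ∀ k : ℕ, 1 ≤ k → ∃ C : ℝ, ∀ x, ‖iteratedFDeriv ℝ k (V i) x‖ ≤ C

/-- The iterated brackets: `bracketSet V k` is `Σ_{k+1}`, where `Σ₁ = {V_i}` and
`Σ_{k+1} = {[V_i, W] | 1 ≤ i ≤ d, W ∈ Σ_k}`. -/
def bracketSet (V : Fin d → EuclideanSpace ℝ (Fin n) → EuclideanSpace ℝ (Fin n)) :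
    ℕ → Set (EuclideanSpace ℝ (Fin n) → EuclideanSpace ℝ (Fin n))
  | 0 => range V
  | k + 1 => {U | ∃ i, ∃ W ∈ bracketSet V k, U = VectorField.lieBracket ℝ (V i) W}

/-- The strong Hörmander condition at every point. -/
def StrongHormander
    (V : Fin d → EuclideanSpace ℝ (Fin n) → EuclideanSpace ℝ (Fin n)) : Prop :=
  ∀ x, Submodule.span ℝ (⋃ k, (fun W => W x) '' bracketSet V k) = ⊤

/-- `φ` solves on `[0,1]` the controlled equation `dφ_t = ∑ᵢ Vᵢ(φ_t) dhᵢ_t`, `φ₀ = x`. -/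
def IsSkeletonSolution (V : Fin d → EuclideanSpace ℝ (Fin n) → EuclideanSpace ℝ (Fin n))
    (x : EuclideanSpace ℝ (Fin n)) (h : CameronMartin d)
    (φ : ℝ → EuclideanSpace ℝ (Fin n)) : Prop :=
  ContinuousOn φ (Icc 0 1) ∧
    ∀ t ∈ Icc (0 : ℝ) 1,
      φ t = x + ∫ s in (0 : ℝ)..t, ∑ i, CameronMartin.velocity d h s i • V i (φ s)

open Classical in
/-- The solution `t ↦ φ(t, x, h)` of the skeleton equation on `[0,1]`. It exists and is unique on
`[0,1]` when the vector fields are smooth with bounded derivatives of all orders `≥ 1`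
(the default value `0` is used if there is no solution). -/
noncomputable def skeletonFlow
    (V : Fin d → EuclideanSpace ℝ (Fin n) → EuclideanSpace ℝ (Fin n))
    (t : ℝ) (x : EuclideanSpace ℝ (Fin n)) (h : CameronMartin d) : EuclideanSpace ℝ (Fin n) :=
  if H : ∃ φ, IsSkeletonSolution V x h φ then H.choose t else 0

/-- The set `𝒦^{x,x'}` of the paths `h ∈ ℋ` with `φ(1, x, h) = x'`. -/
def pathsBetween (V : Fin d → EuclideanSpace ℝ (Fin n) → EuclideanSpace ℝ (Fin n))
    (x x' : EuclideanSpace ℝ (Fin n)) : Set (CameronMartin d) :=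
  {h | skeletonFlow V 1 x h = x'}

/-- The `i`-th component `Dφ₁ⁱ(h) ∈ ℋ*` of the Fréchet derivative of `h ↦ φ(1, x, h)`. -/
noncomputable def skeletonDeriv
    (V : Fin d → EuclideanSpace ℝ (Fin n) → EuclideanSpace ℝ (Fin n))
    (x : EuclideanSpace ℝ (Fin n)) (h : CameronMartin d) (i : Fin n) :
    StrongDual ℝ (CameronMartin d) :=
  (EuclideanSpace.proj i).comp (fderiv ℝ (fun k => skeletonFlow V 1 x k) h)

/-- The deterministic Malliavin covariance matrix `σ_{φ₁}(h) = (⟪Dφ₁ⁱ(h), Dφ₁ʲ(h)⟫_{ℋ*})_{i,j}`,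
where the inner product of `ℋ*` is that of `ℋ` under the Riesz isomorphism. -/
noncomputable def malliavinCovariance
    (V : Fin d → EuclideanSpace ℝ (Fin n) → EuclideanSpace ℝ (Fin n))
    (x : EuclideanSpace ℝ (Fin n)) (h : CameronMartin d) : Matrix (Fin n) (Fin n) ℝ :=
  Matrix.of fun i j =>
    ⟪(InnerProductSpace.toDual ℝ (CameronMartin d)).symm (skeletonDeriv V x h i),
      (InnerProductSpace.toDual ℝ (CameronMartin d)).symm (skeletonDeriv V x h j)⟫_ℝ

end Skeleton

/-- `⟪h, ·⟫_ℋ` extends to a continuous linear functional on Wiener space. -/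
def ExtendsToWiener {d : ℕ} (h : CameronMartin d) : Prop :=
  ∃ ℓ : WienerSpace d →L[ℝ] ℝ, ∀ k : CameronMartin d, ℓ (CameronMartin.toWiener d k) = ⟪h, k⟫_ℝ

/-! The control `h` is modified only by inserting a short loop at the start: a control `u` is run on
`[0, δ]`, then undone on `[δ, 2δ]`, after which `h` is followed at higher speed. The end point does
not change (`solutionMap_loop_one`), and the modification tends to `0` in `ℋ` as `δ → 0`, because
`u` is bounded and dilations act continuously on `L²`.

The control `u` is chosen so that the loop alone forces nondegeneracy. It equals the basis vector
`e_j` on a set `A j`, where the `A j` are disjoint and each meets every open interval in positive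
measure. If `p` is orthogonal to the range of `Dφ₁`, let `q` solve the adjoint equation along `φ`
with `q 1 = p`. Duality gives `⟪q, V_i(φ)⟫ = 0` on `[0,1]`. Whenever `⟪q, W(φ)⟫` vanishes on `[0,
δ]`, differentiating at almost every point of `A j` gives `⟪q, [V_j, W](φ)⟫ = 0` there, hence on all
of `[0, δ]` by density and continuity. By induction `q 0` is orthogonal to every iterated bracket at
`x`, so Hörmander's condition gives `q 0 = 0`, and then `p = 0`
(`eq_zero_of_forall_inner_fderiv_solutionMap_eq_zero`). No rank or genericity argument is needed.

For (ii), the elements of `ℋ` that extend to `𝒲` form a dense subspace. Near a point where the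
derivative is onto `ℝⁿ`, a level set meets every dense subspace
(`HasStrictFDerivAt.exists_mem_dense_submodule_eq`), and a nonzero determinant is an open condition.

The calculus rests on a contraction argument for Volterra equations in an exponentially weighted
norm and on the implicit function theorem, which makes the solution map `C¹`. -/

/-- The Banach space of continuous paths `[0,1] → F` with the sup-norm. -/
def PathSpace (F : Type*) [NormedAddCommGroup F] : Type _ := C(unitInterval, F)

namespace PathSpace

variable {F : Type*} [NormedAddCommGroup F]

noncomputable instance : NormedAddCommGroup (PathSpace F) :=
  inferInstanceAs (NormedAddCommGroup C(unitInterval, F))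

noncomputable instance [NormedSpace ℝ F] : NormedSpace ℝ (PathSpace F) :=
  inferInstanceAs (NormedSpace ℝ C(unitInterval, F))

instance [CompleteSpace F] : CompleteSpace (PathSpace F) :=
  inferInstanceAs (CompleteSpace C(unitInterval, F))

instance : FunLike (PathSpace F) unitInterval F :=
  inferInstanceAs (FunLike C(unitInterval, F) unitInterval F)

/-- The path given by a continuous function. -/
def mk (f : unitInterval → F) (hf : Continuous f) : PathSpace F := (⟨f, hf⟩ : C(unitInterval, F))

@[simp]
theorem mk_apply (f : unitInterval → F) (hf : Continuous f) (t : unitInterval) :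
    mk f hf t = f t := rfl

/-- The constant path. -/
def const (x : F) : PathSpace F := mk (fun _ => x) continuous_const

@[simp]
theorem const_apply (x : F) (t : unitInterval) : const x t = x := rfl

@[ext]
theorem ext {φ ψ : PathSpace F} (h : ∀ t, φ t = ψ t) : φ = ψ := DFunLike.ext _ _ h

@[fun_prop]
protected theorem continuous (φ : PathSpace F) : Continuous φ := ContinuousMap.continuous φ

@[simp]
theorem add_apply (φ ψ : PathSpace F) (t : unitInterval) : (φ + ψ) t = φ t + ψ t := rfl

@[simp]
theorem sub_apply (φ ψ : PathSpace F) (t : unitInterval) : (φ - ψ) t = φ t - ψ t := rfl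

@[simp]
theorem smul_apply [NormedSpace ℝ F] (c : ℝ) (φ : PathSpace F) (t : unitInterval) :
    (c • φ) t = c • φ t := rfl

theorem norm_le (φ : PathSpace F) {C : ℝ} (hC : 0 ≤ C) : ‖φ‖ ≤ C ↔ ∀ t, ‖φ t‖ ≤ C :=
  ContinuousMap.norm_le φ hC

theorem norm_coe_le_norm (φ : PathSpace F) (t : unitInterval) : ‖φ t‖ ≤ ‖φ‖ :=
  ContinuousMap.norm_coe_le_norm φ t

/-- Evaluation at a time, as a continuous linear map. -/
noncomputable def evalCLM [NormedSpace ℝ F] (t : unitInterval) : PathSpace F →L[ℝ] F :=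
  LinearMap.mkContinuous
    { toFun := fun φ => φ t, map_add' := fun _ _ => rfl, map_smul' := fun _ _ => rfl } 1
    fun φ => by rw [one_mul]; exact φ.norm_coe_le_norm t

end PathSpace

/-! ### Volterra equations driven by `L²` velocities -/

section Volterra

variable {d : ℕ} {F : Type*} [NormedAddCommGroup F] [NormedSpace ℝ F]

theorem VelocitySpace.integrableOn_Icc {d : ℕ} (v : VelocitySpace d) :
    IntegrableOn (fun s => v s) (Icc 0 1) := (Lp.memLp v).integrable (by norm_num)

theorem integrableOn_extend_apply (z : PathSpace (EuclideanSpace ℝ (Fin d) →L[ℝ] F))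
    (v : VelocitySpace d) :
    IntegrableOn (fun s => IccExtend zero_le_one z s (v s)) (Icc 0 1) := by
  have hz : Continuous (IccExtend (zero_le_one (α := ℝ)) z) := z.continuous.Icc_extend'
  refine (v.integrableOn_Icc.norm.const_mul ‖z‖).mono' ?_ ?_
  · exact (ContinuousLinearMap.id ℝ (EuclideanSpace ℝ (Fin d) →L[ℝ] F)).aestronglyMeasurable_comp₂
      hz.aestronglyMeasurable v.integrableOn_Icc.aestronglyMeasurable
  · refine Filter.Eventually.of_forall fun s => ?_
    exact (ContinuousLinearMap.le_opNorm _ _).trans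
      (mul_le_mul_of_nonneg_right (z.norm_coe_le_norm _) (norm_nonneg _))

theorem intervalIntegrable_extend_apply (z : PathSpace (EuclideanSpace ℝ (Fin d) →L[ℝ] F))
    (v : VelocitySpace d) {a b : ℝ} (ha : a ∈ Icc (0 : ℝ) 1) (hb : b ∈ Icc (0 : ℝ) 1) :
    IntervalIntegrable (fun s => IccExtend zero_le_one z s (v s)) volume a b := by
  rw [intervalIntegrable_iff]
  exact (integrableOn_extend_apply z v).mono_set
    (uIoc_subset_uIcc.trans (ordConnected_Icc.uIcc_subset ha hb))

theorem VelocitySpace.setIntegral_norm_sq_le (v : VelocitySpace d) {t : ℝ} (ht : t ≤ 1) :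
    ∫ s in Ioc 0 t, ‖v s‖ ^ 2 ≤ ‖v‖ ^ 2 := by
  have h1 : ‖v‖ ^ 2 = ∫ s in Icc (0 : ℝ) 1, ‖v s‖ ^ 2 := by
    rw [← real_inner_self_eq_norm_sq, L2.inner_def]
    simp
  rw [h1]
  refine setIntegral_mono_set ((Lp.memLp v).integrable_norm_pow (by norm_num)) ?_ ?_
  · exact Filter.Eventually.of_forall fun s => by positivity
  · exact (Ioc_subset_Icc_self.trans (Icc_subset_Icc_right ht)).eventuallyLE

/-- Cauchy–Schwarz together with `∫₀ᵗ e^{2ls} ds ≤ e^{2lt}/(2l)`. The gain `1/√(2l)` makes the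
Volterra operator a contraction in a weighted norm once `l` is large. -/
theorem norm_integral_extend_apply_le (z : PathSpace (EuclideanSpace ℝ (Fin d) →L[ℝ] F))
    (v : VelocitySpace d) {c l : ℝ} (hl : 0 < l)
    (hz : ∀ s : unitInterval, ‖z s‖ ≤ c * Real.exp (l * s)) (t : unitInterval) :
    ‖∫ s in (0 : ℝ)..t, IccExtend zero_le_one z s (v s)‖ ≤
      c * (‖v‖ / √(2 * l)) * Real.exp (l * t) := by
  have hc : 0 ≤ c := by
    have := (norm_nonneg _).trans (hz 0)
    exact nonneg_of_mul_nonneg_left this (Real.exp_pos _)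
  have hsub : Ioc 0 (t : ℝ) ⊆ Icc 0 1 := Ioc_subset_Icc_self.trans (Icc_subset_Icc_right t.2.2)
  have hv : MemLp (fun s => ‖v s‖) 2 (volume.restrict (Ioc 0 (t : ℝ))) :=
    ((Lp.memLp v).mono_measure (Measure.restrict_mono hsub le_rfl)).norm
  have he : MemLp (fun s => Real.exp (l * s)) 2 (volume.restrict (Ioc 0 (t : ℝ))) := by
    have : Continuous fun s => Real.exp (l * s) := by fun_prop
    refine MemLp.of_bound this.aestronglyMeasurable (Real.exp (l * t)) ?_
    filter_upwards [ae_restrict_mem measurableSet_Ioc] with s hs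
    rw [Real.norm_eq_abs, abs_of_pos (Real.exp_pos _)]
    exact Real.exp_le_exp.mpr (mul_le_mul_of_nonneg_left hs.2 hl.le)
  have hhol : ∫ s in Ioc 0 (t : ℝ), Real.exp (l * s) * ‖v s‖ ≤
      (Real.exp (l * t) / √(2 * l)) * ‖v‖ := by
    have h0 := integral_mul_le_Lp_mul_Lq_of_nonneg (μ := volume.restrict (Ioc 0 (t : ℝ)))
      (f := fun s => Real.exp (l * s)) (g := fun s => ‖v s‖) Real.HolderConjugate.two_two
      (Filter.Eventually.of_forall fun s => (Real.exp_pos _).le)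
      (Filter.Eventually.of_forall fun s => norm_nonneg _)
      (by simpa using he) (by simpa using hv)
    refine h0.trans ?_
    simp only [Real.rpow_two, ← Real.sqrt_eq_rpow]
    gcongr
    · rw [Real.sqrt_le_left (by positivity), div_pow, Real.sq_sqrt (by positivity),
        ← intervalIntegral.integral_of_le t.2.1]
      have : (fun s => Real.exp (l * s) ^ 2) = fun s => Real.exp ((2 * l) * s) := by
        funext s
        rw [← Real.exp_nat_mul]
        congr 1
        push_cast
        ring
      rw [this, intervalIntegral.integral_comp_mul_left (fun s => Real.exp s) (by positivity),
        integral_exp, ← Real.exp_nat_mul, smul_eq_mul, inv_mul_eq_div]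
      gcongr
      have : (2 * l * t) = (2 : ℕ) * (l * t) := by push_cast; ring
      rw [this]
      linarith [Real.exp_pos (2 * l * 0)]
    · rw [Real.sqrt_le_left (by positivity)]
      exact v.setIntegral_norm_sq_le t.2.2
  calc ‖∫ s in (0 : ℝ)..t, IccExtend zero_le_one z s (v s)‖
      ≤ ∫ s in (0 : ℝ)..t, c * (Real.exp (l * s) * ‖v s‖) := by
        refine intervalIntegral.norm_integral_le_of_norm_le t.2.1 ?_ ?_
        · refine Filter.Eventually.of_forall fun s hs => ?_
          rw [IccExtend_of_mem _ _ (hsub hs), ← mul_assoc]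
          exact (ContinuousLinearMap.le_opNorm _ _).trans
            (mul_le_mul_of_nonneg_right (hz ⟨s, hsub hs⟩) (norm_nonneg _))
        · rw [intervalIntegrable_iff_integrableOn_Ioc_of_le t.2.1]
          exact (he.integrable_mul hv).const_mul c
    _ = c * ∫ s in Ioc 0 (t : ℝ), Real.exp (l * s) * ‖v s‖ := by
        rw [intervalIntegral.integral_const_mul, intervalIntegral.integral_of_le t.2.1]
    _ ≤ c * ((Real.exp (l * t) / √(2 * l)) * ‖v‖) := by gcongr
    _ = _ := by ring

/-- The path `t ↦ ∫₀ᵗ z(s) v(s) ds`. -/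
noncomputable def volterraPath (z : PathSpace (EuclideanSpace ℝ (Fin d) →L[ℝ] F))
    (v : VelocitySpace d) : PathSpace F :=
  .mk (fun t => ∫ s in (0 : ℝ)..t, IccExtend zero_le_one z s (v s)) <| by
    have h := intervalIntegral.continuousOn_primitive_interval
      (f := fun s => IccExtend zero_le_one z s (v s)) (μ := volume) (a := 0) (b := 1)
      (by rw [uIcc_of_le zero_le_one]; exact integrableOn_extend_apply z v)
    rw [uIcc_of_le zero_le_one] at h
    exact continuousOn_iff_continuous_domRestrict.mp h

theorem volterraPath_apply (z : PathSpace (EuclideanSpace ℝ (Fin d) →L[ℝ] F))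
    (v : VelocitySpace d) (t : unitInterval) :
    volterraPath z v t = ∫ s in (0 : ℝ)..t, IccExtend zero_le_one z s (v s) := rfl

theorem ae_restrict_uIoc_of_ae_Icc {p : ℝ → Prop} {t : ℝ} (ht : t ∈ Icc (0 : ℝ) 1)
    (h : ∀ᵐ s ∂(volume.restrict (Icc (0 : ℝ) 1)), p s) : ∀ᵐ s, s ∈ uIoc 0 t → p s := by
  rw [ae_restrict_iff' measurableSet_Icc] at h
  filter_upwards [h] with s hs hst
  rw [uIoc_of_le ht.1] at hst
  exact hs ⟨hst.1.le, hst.2.trans ht.2⟩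

/-- The bilinear map `(z, v) ↦ ∫₀^· z(s) v(s) ds`. -/
noncomputable def volterraLinear (d : ℕ) (F : Type*) [NormedAddCommGroup F] [NormedSpace ℝ F] :
    PathSpace (EuclideanSpace ℝ (Fin d) →L[ℝ] F) →ₗ[ℝ] VelocitySpace d →ₗ[ℝ] PathSpace F :=
  LinearMap.mk₂ ℝ volterraPath
    (fun z z' v => by
      refine PathSpace.ext fun t => ?_
      change volterraPath (z + z') v t = volterraPath z v t + volterraPath z' v t
      simp only [volterraPath_apply]
      rw [← intervalIntegral.integral_add
        (intervalIntegrable_extend_apply z v ⟨le_rfl, zero_le_one⟩ t.2)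
        (intervalIntegrable_extend_apply z' v ⟨le_rfl, zero_le_one⟩ t.2)]
      rfl)
    (fun c z v => by
      refine PathSpace.ext fun t => ?_
      change volterraPath (c • z) v t = c • volterraPath z v t
      simp only [volterraPath_apply]
      rw [← intervalIntegral.integral_smul]
      rfl)
    (fun z v v' => by
      refine PathSpace.ext fun t => ?_
      change volterraPath z (v + v') t = volterraPath z v t + volterraPath z v' t
      simp only [volterraPath_apply]
      rw [← intervalIntegral.integral_add
        (intervalIntegrable_extend_apply z v ⟨le_rfl, zero_le_one⟩ t.2)
        (intervalIntegrable_extend_apply z v' ⟨le_rfl, zero_le_one⟩ t.2)]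
      refine intervalIntegral.integral_congr_ae ?_
      refine ae_restrict_uIoc_of_ae_Icc t.2 ?_
      filter_upwards [Lp.coeFn_add v v'] with s hs
      rw [hs, Pi.add_apply, map_add])
    (fun c z v => by
      refine PathSpace.ext fun t => ?_
      change volterraPath z (c • v) t = c • volterraPath z v t
      simp only [volterraPath_apply]
      rw [← intervalIntegral.integral_smul]
      refine intervalIntegral.integral_congr_ae ?_
      refine ae_restrict_uIoc_of_ae_Icc t.2 ?_
      filter_upwards [Lp.coeFn_smul c v] with s hs
      rw [hs, Pi.smul_apply, map_smul])

theorem norm_volterraLinear_le (z : PathSpace (EuclideanSpace ℝ (Fin d) →L[ℝ] F))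
    (v : VelocitySpace d) : ‖volterraLinear d F z v‖ ≤ Real.exp 2⁻¹ * ‖z‖ * ‖v‖ := by
  refine (PathSpace.norm_le _ (by positivity)).mpr fun t => ?_
  -- The choice `l = 1/2` makes `√(2l) = 1` and produces the constant `exp(1/2)`.
  refine (norm_integral_extend_apply_le z v (c := ‖z‖) (l := 2⁻¹) (by norm_num)
    (fun s => ?_) t).trans ?_
  · refine (z.norm_coe_le_norm s).trans (le_mul_of_one_le_right (norm_nonneg _) ?_)
    exact Real.one_le_exp (mul_nonneg (by norm_num) s.2.1)
  · have h1 : √(2 * 2⁻¹ : ℝ) = 1 := by norm_num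
    have h2 : Real.exp (2⁻¹ * (t : ℝ)) ≤ Real.exp 2⁻¹ :=
      Real.exp_le_exp.mpr (by linarith [t.2.2])
    rw [h1, div_one]
    calc ‖z‖ * ‖v‖ * Real.exp (2⁻¹ * (t : ℝ)) ≤ ‖z‖ * ‖v‖ * Real.exp 2⁻¹ := by gcongr
      _ = _ := by ring

/-- The continuous bilinear map `(z, v) ↦ ∫₀^· z(s) v(s) ds`. -/
noncomputable def volterra (d : ℕ) (F : Type*) [NormedAddCommGroup F] [NormedSpace ℝ F] :
    PathSpace (EuclideanSpace ℝ (Fin d) →L[ℝ] F) →L[ℝ] VelocitySpace d →L[ℝ] PathSpace F :=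
  LinearMap.mkContinuous₂ (volterraLinear d F) (Real.exp 2⁻¹) norm_volterraLinear_le

theorem volterra_apply (z : PathSpace (EuclideanSpace ℝ (Fin d) →L[ℝ] F))
    (v : VelocitySpace d) (t : unitInterval) :
    volterra d F z v t = ∫ s in (0 : ℝ)..t, IccExtend zero_le_one z s (v s) := rfl

theorem norm_volterra_apply_le (z : PathSpace (EuclideanSpace ℝ (Fin d) →L[ℝ] F))
    (v : VelocitySpace d) {c l : ℝ} (hl : 0 < l)
    (hz : ∀ s : unitInterval, ‖z s‖ ≤ c * Real.exp (l * s)) (t : unitInterval) :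
    ‖volterra d F z v t‖ ≤ c * (‖v‖ / √(2 * l)) * Real.exp (l * t) :=
  norm_integral_extend_apply_le z v hl hz t

/-- Multiplication of a path by `t ↦ e^{lt}`. -/
noncomputable def expWeight (l : ℝ) (ξ : PathSpace F) : PathSpace F :=
  .mk (fun t => Real.exp (l * t) • ξ t) (by fun_prop)

theorem expWeight_apply (l : ℝ) (ξ : PathSpace F) (t : unitInterval) :
    expWeight l ξ t = Real.exp (l * t) • ξ t := rfl

theorem expWeight_neg_expWeight (l : ℝ) (ξ : PathSpace F) :
    expWeight (-l) (expWeight l ξ) = ξ := by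
  ext t
  simp [expWeight_apply, smul_smul, ← Real.exp_add]

theorem expWeight_expWeight_neg (l : ℝ) (ξ : PathSpace F) :
    expWeight l (expWeight (-l) ξ) = ξ := by
  ext t
  simp [expWeight_apply, smul_smul, ← Real.exp_add]

/-- Well-posedness of the Volterra equation `φ = f + ∫₀^· N(φ)(s) v(s) ds`. -/
theorem existsUnique_eq_add_volterra [CompleteSpace F]
    (N : PathSpace F → PathSpace (EuclideanSpace ℝ (Fin d) →L[ℝ] F)) {K : ℝ}
    (hN : ∀ φ ψ (s : unitInterval), ‖N φ s - N ψ s‖ ≤ K * ‖φ s - ψ s‖)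
    (f : PathSpace F) (v : VelocitySpace d) :
    ∃! φ : PathSpace F, φ = f + volterra d F (N φ) v := by
  -- The value of `l` is chosen so that `√(2l) = 2(|K|‖v‖ + 1)`, which gives contraction factor
  -- `1/2`.
  obtain ⟨l, hl, hlK⟩ : ∃ l : ℝ, 0 < l ∧ |K| * (‖v‖ / √(2 * l)) ≤ 1 / 2 := by
    refine ⟨2 * (|K| * ‖v‖ + 1) ^ 2, by positivity, ?_⟩
    have : √(2 * (2 * (|K| * ‖v‖ + 1) ^ 2)) = 2 * (|K| * ‖v‖ + 1) := by
      rw [show 2 * (2 * (|K| * ‖v‖ + 1) ^ 2) = (2 * (|K| * ‖v‖ + 1)) ^ 2 by ring,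
        Real.sqrt_sq (by positivity)]
    rw [this, ← mul_div_assoc, div_le_div_iff₀ (by positivity) (by norm_num)]
    linarith
  -- Conjugation by the weight `e^{lt}` turns the weighted norm back into the sup-norm, so a single
  -- contraction covers all of `[0,1]`.
  let T : PathSpace F → PathSpace F := fun ξ =>
    expWeight (-l) (f + volterra d F (N (expWeight l ξ)) v)
  have hT : ContractingWith (1 / 2 : NNReal) T := by
    refine ⟨by rw [← NNReal.coe_lt_coe]; norm_num, LipschitzWith.of_dist_le_mul fun ξ η => ?_⟩
    rw [dist_eq_norm, dist_eq_norm]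
    refine (PathSpace.norm_le _ (by positivity)).mpr fun t => ?_
    have h1 : (T ξ - T η) t = Real.exp (-l * t) •
        volterra d F (N (expWeight l ξ) - N (expWeight l η)) v t := by
      rw [map_sub]
      change Real.exp (-l * t) • (f t + _) - Real.exp (-l * t) • (f t + _) =
        Real.exp (-l * t) • (volterra d F (N (expWeight l ξ)) v t -
          volterra d F (N (expWeight l η)) v t)
      rw [← smul_sub, add_sub_add_left_eq_sub]
      rfl
    have h2 := norm_volterra_apply_le (N (expWeight l ξ) - N (expWeight l η)) v
      (c := |K| * ‖ξ - η‖) hl (fun s => by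
        rw [PathSpace.sub_apply]
        refine (hN _ _ s).trans ?_
        rw [expWeight_apply, expWeight_apply, ← smul_sub, norm_smul, Real.norm_eq_abs,
          abs_of_pos (Real.exp_pos _), ← PathSpace.sub_apply]
        calc K * (Real.exp (l * s) * ‖(ξ - η) s‖)
            ≤ |K| * (Real.exp (l * s) * ‖ξ - η‖) := by
              gcongr
              · exact le_abs_self K
              · exact (ξ - η).norm_coe_le_norm s
          _ = _ := by ring) t
    rw [h1, norm_smul, Real.norm_eq_abs, abs_of_pos (Real.exp_pos _)]
    calc Real.exp (-l * t) * ‖volterra d F (N (expWeight l ξ) - N (expWeight l η)) v t‖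
        ≤ Real.exp (-l * t) * (|K| * ‖ξ - η‖ * (‖v‖ / √(2 * l)) * Real.exp (l * t)) := by gcongr
      _ = (|K| * (‖v‖ / √(2 * l))) * ‖ξ - η‖ * (Real.exp (-l * t) * Real.exp (l * t)) := by ring
      _ = (|K| * (‖v‖ / √(2 * l))) * ‖ξ - η‖ := by
          rw [← Real.exp_add]
          simp
      _ ≤ ((1 / 2 : NNReal) : ℝ) * ‖ξ - η‖ := by
          gcongr
          simpa using hlK
  have hfix : ∀ φ, φ = f + volterra d F (N φ) v ↔
      Function.IsFixedPt T (expWeight (-l) φ) := by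
    intro φ
    simp only [Function.IsFixedPt, T, expWeight_expWeight_neg]
    constructor
    · intro h
      rw [← h]
    · intro h
      have := congrArg (expWeight l) h
      rw [expWeight_expWeight_neg, expWeight_expWeight_neg] at this
      exact this.symm
  refine ⟨expWeight l (hT.fixedPoint T), ?_, fun ψ hψ => ?_⟩
  · change _ = _
    rw [hfix, expWeight_neg_expWeight]
    exact hT.fixedPoint_isFixedPt
  · have := hT.fixedPoint_unique ((hfix ψ).mp hψ)
    rw [← this, expWeight_expWeight_neg]

end Volterra

/-! ### Differentiability of superposition operators -/

section Superposition

variable {F G : Type*} [NormedAddCommGroup F] [NormedSpace ℝ F]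
  [NormedAddCommGroup G] [NormedSpace ℝ G]

/-- The pointwise application of a path of operators to a path, as a bilinear map. -/
noncomputable def pathApplyLinear (F G : Type*) [NormedAddCommGroup F] [NormedSpace ℝ F]
    [NormedAddCommGroup G] [NormedSpace ℝ G] :
    PathSpace (F →L[ℝ] G) →ₗ[ℝ] PathSpace F →ₗ[ℝ] PathSpace G :=
  LinearMap.mk₂ ℝ (fun τ ξ => .mk (fun t => τ t (ξ t)) (by fun_prop))
    (fun _ _ _ => by ext; simp) (fun _ _ _ => by ext; simp)
    (fun _ _ _ => by ext; simp) (fun _ _ _ => by ext; simp)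

/-- The pointwise application of a path of operators to a path, as a continuous bilinear map. -/
noncomputable def pathApply (F G : Type*) [NormedAddCommGroup F] [NormedSpace ℝ F]
    [NormedAddCommGroup G] [NormedSpace ℝ G] :
    PathSpace (F →L[ℝ] G) →L[ℝ] PathSpace F →L[ℝ] PathSpace G :=
  LinearMap.mkContinuous₂ (pathApplyLinear F G) 1 fun τ ξ => by
      refine (PathSpace.norm_le _ (by positivity)).mpr fun t => ?_
      rw [one_mul]
      exact ((τ t).le_opNorm (ξ t)).trans
        (mul_le_mul (τ.norm_coe_le_norm t) (ξ.norm_coe_le_norm t) (norm_nonneg _)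
          (norm_nonneg τ))

theorem exists_norm_pathApply_le (τ : PathSpace (F →L[ℝ] G)) :
    ∃ K : ℝ, ∀ (ξ : PathSpace F) (t : unitInterval),
      ‖pathApply F G τ ξ t‖ ≤ K * ‖ξ t‖ :=
  ⟨‖τ‖, fun ξ t => ((τ t).le_opNorm (ξ t)).trans
    (mul_le_mul_of_nonneg_right (τ.norm_coe_le_norm t) (norm_nonneg _))⟩

/-- The superposition operator `φ ↦ σ ∘ φ` on paths. -/
def superpose {F G : Type*} [NormedAddCommGroup F] [NormedAddCommGroup G] {σ : F → G}
    (hσ : Continuous σ) (φ : PathSpace F) : PathSpace G :=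
  .mk (fun t => σ (φ t)) (by fun_prop)

@[simp]
theorem superpose_apply {F G : Type*} [NormedAddCommGroup F] [NormedAddCommGroup G] {σ : F → G}
    (hσ : Continuous σ) (φ : PathSpace F)
    (t : unitInterval) : superpose hσ φ t = σ (φ t) := rfl

theorem continuous_superpose {F G : Type*} [NormedAddCommGroup F] [NormedAddCommGroup G] {σ : F → G}
    (hσ : Continuous σ) : Continuous (superpose hσ) :=
  ContinuousMap.continuous_postcomp (⟨σ, hσ⟩ : C(F, G))

/-- The mean value inequality is applied at each time. Its constant is uniform in time because
composition with `fderiv ℝ σ` is continuous in the sup-norm. -/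
theorem hasFDerivAt_superpose {σ : F → G} (hσ : ContDiff ℝ 1 σ) (φ : PathSpace F) :
    HasFDerivAt (superpose hσ.continuous)
      (pathApply F G (superpose (hσ.continuous_fderiv one_ne_zero) φ)) φ := by
  refine HasFDerivAt.of_isLittleO (Asymptotics.IsLittleO.of_bound fun c hc => ?_)
  have hcont := (continuous_superpose (hσ.continuous_fderiv one_ne_zero)).continuousAt (x := φ)
  obtain ⟨δ, hδ, hball⟩ := Metric.continuousAt_iff.mp hcont c hc
  filter_upwards [Metric.ball_mem_nhds φ hδ] with ψ hψ
  refine (PathSpace.norm_le _ (by positivity)).mpr fun t => ?_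
  change ‖σ (ψ t) - σ (φ t) - fderiv ℝ σ (φ t) ((ψ - φ) t)‖ ≤ c * ‖ψ - φ‖
  have hmv := (convex_segment (φ t) (ψ t)).norm_image_sub_le_of_norm_hasFDerivWithin_le'
    (f := σ) (f' := fderiv ℝ σ) (φ := fderiv ℝ σ (φ t)) (C := c)
    (fun y _ => ((hσ.differentiable one_ne_zero) y).hasFDerivAt.hasFDerivWithinAt)
    (fun y hy => by
      rw [segment_eq_image'] at hy
      obtain ⟨r, hr, rfl⟩ := hy
      -- A point of the segment from `φ t` to `ψ t` is the value at `t` of a whole path within `δ`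
      -- of `φ`.
      have h1 : dist (φ + r • (ψ - φ)) φ < δ := by
        rw [dist_eq_norm, add_sub_cancel_left, norm_smul, Real.norm_eq_abs, abs_of_nonneg hr.1]
        refine (mul_le_of_le_one_left (norm_nonneg _) hr.2).trans_lt ?_
        rwa [← dist_eq_norm]
      have h2 := hball h1
      rw [dist_eq_norm] at h2
      exact (PathSpace.norm_coe_le_norm (superpose (hσ.continuous_fderiv one_ne_zero)
        (φ + r • (ψ - φ)) - superpose (hσ.continuous_fderiv one_ne_zero) φ) t).trans h2.le)
    (left_mem_segment ℝ _ _) (right_mem_segment ℝ _ _)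
  refine hmv.trans ?_
  gcongr
  exact (ψ - φ).norm_coe_le_norm t

theorem contDiff_superpose {σ : F → G} (hσ : ContDiff ℝ 1 σ) :
    ContDiff ℝ 1 (superpose hσ.continuous) :=
  contDiff_one_iff_hasFDerivAt.mpr ⟨_, (pathApply F G).continuous.comp
    (continuous_superpose (hσ.continuous_fderiv one_ne_zero)), hasFDerivAt_superpose hσ⟩

end Superposition

/-! ### The solution map is `C¹` in the control -/

section SolutionMap

variable {d : ℕ} {F : Type*} [NormedAddCommGroup F] [NormedSpace ℝ F]
  {σ : F → EuclideanSpace ℝ (Fin d) →L[ℝ] F} {K : NNReal}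

theorem contDiff_volterra_superpose (hσ : ContDiff ℝ 1 σ) :
    ContDiff ℝ 1 fun p : VelocitySpace d × PathSpace F =>
      volterra d F (superpose hσ.continuous p.2) p.1 := by
  have h1 : ContDiff ℝ 1 fun p : VelocitySpace d × PathSpace F =>
      superpose hσ.continuous p.2 := (contDiff_superpose hσ).comp contDiff_snd
  have h2 : ContDiff ℝ 1 fun p : VelocitySpace d × PathSpace F =>
      volterra d F (superpose hσ.continuous p.2) :=
    (ContinuousLinearMap.contDiff (volterra d F)).comp h1
  exact h2.clm_apply contDiff_fst

/-- The map whose zeros are the pairs `(v, φ)` with `φ` the solution for the velocity `v`. -/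
noncomputable def solutionDefect (hσ : Continuous σ) (x : F)
    (p : VelocitySpace d × PathSpace F) : PathSpace F :=
  p.2 - (PathSpace.const x + volterra d F (superpose hσ p.2) p.1)

theorem contDiff_solutionDefect (hσ : ContDiff ℝ 1 σ) (x : F) :
    ContDiff ℝ 1 (solutionDefect hσ.continuous x : VelocitySpace d × PathSpace F → _) :=
  contDiff_snd.sub (contDiff_const.add (contDiff_volterra_superpose hσ))

theorem hasFDerivAt_volterra_superpose (hσ : ContDiff ℝ 1 σ) (v : VelocitySpace d)
    (φ : PathSpace F) :
    HasFDerivAt (fun ψ => volterra d F (superpose hσ.continuous ψ) v)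
      ((volterra d F).flip v ∘L
        pathApply F _ (superpose (hσ.continuous_fderiv one_ne_zero) φ)) φ :=
  HasFDerivAt.comp φ (ContinuousLinearMap.hasFDerivAt ((volterra d F).flip v))
    (hasFDerivAt_superpose hσ φ)

theorem isInvertible_of_bijective {E F : Type*} [NormedAddCommGroup E] [NormedSpace ℝ E]
    [CompleteSpace E] [NormedAddCommGroup F] [NormedSpace ℝ F] [CompleteSpace F] (f : E →L[ℝ] F)
    (hf : Function.Bijective f) : f.IsInvertible :=
  ⟨ContinuousLinearEquiv.ofBijective f (LinearMap.ker_eq_bot.mpr hf.1)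
    (LinearMap.range_eq_top.mpr hf.2), ContinuousLinearEquiv.coe_ofBijective _ _ _⟩

variable [CompleteSpace F]

/-- The linear operator `ξ ↦ ξ - ∫₀^· τ(s)(ξ(s)) v(s) ds` is invertible. -/
theorem bijective_sub_volterra_pathApply
    (τ : PathSpace (F →L[ℝ] EuclideanSpace ℝ (Fin d) →L[ℝ] F)) (v : VelocitySpace d) :
    Function.Bijective fun ξ : PathSpace F => ξ - volterra d F (pathApply _ _ τ ξ) v := by
  rw [Function.bijective_iff_existsUnique]
  intro f
  obtain ⟨K, hK⟩ := exists_norm_pathApply_le τ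
  have h := existsUnique_eq_add_volterra (fun ξ => pathApply _ _ τ ξ) (K := K)
    (fun φ ψ s => by
      have := hK (φ - ψ) s
      rw [map_sub] at this
      exact this) f v
  simpa only [sub_eq_iff_eq_add] using h

theorem existsUnique_solution (hσ : Continuous σ) (hK : LipschitzWith K σ) (x : F)
    (v : VelocitySpace d) :
    ∃! φ : PathSpace F,
      φ = PathSpace.const x + volterra d F (superpose hσ φ) v :=
  existsUnique_eq_add_volterra (superpose hσ) (K := K)
    (fun φ ψ s => by
      rw [superpose_apply, superpose_apply, ← dist_eq_norm, ← dist_eq_norm]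
      exact hK.dist_le_mul _ _) _ v

/-- The solution of `dφ = σ(φ) v dt`, `φ₀ = x`, as a function of the velocity `v` of the control. -/
noncomputable def solutionMap (hσ : Continuous σ) (hK : LipschitzWith K σ) (x : F)
    (v : VelocitySpace d) : PathSpace F :=
  (existsUnique_solution hσ hK x v).choose

theorem solutionMap_eq (hσ : Continuous σ) (hK : LipschitzWith K σ) (x : F)
    (v : VelocitySpace d) : solutionMap hσ hK x v =
      PathSpace.const x + volterra d F (superpose hσ (solutionMap hσ hK x v)) v :=
  (existsUnique_solution hσ hK x v).choose_spec.1

theorem eq_solutionMap (hσ : Continuous σ) (hK : LipschitzWith K σ) {x : F}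
    {v : VelocitySpace d} {φ : PathSpace F}
    (h : φ = PathSpace.const x + volterra d F (superpose hσ φ) v) :
    φ = solutionMap hσ hK x v :=
  (existsUnique_solution hσ hK x v).choose_spec.2 φ h

theorem solutionDefect_eq_zero_iff (hσ : Continuous σ) (hK : LipschitzWith K σ) {x : F}
    {v : VelocitySpace d} {φ : PathSpace F} :
    solutionDefect hσ x (v, φ) = 0 ↔ φ = solutionMap hσ hK x v := by
  rw [solutionDefect, sub_eq_zero]
  refine ⟨eq_solutionMap hσ hK, ?_⟩
  rintro rfl
  exact solutionMap_eq hσ hK x v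

/-- The partial derivative in the path is the identity minus a linear Volterra operator, and the
linear equation is uniquely solvable. -/
theorem isInvertible_fderiv_solutionDefect (hσ : ContDiff ℝ 1 σ) (x : F) (v : VelocitySpace d)
    (φ : PathSpace F) :
    (fderiv ℝ (solutionDefect hσ.continuous x) (v, φ) ∘L
      .inr ℝ (VelocitySpace d) (PathSpace F)).IsInvertible := by
  have h1 : HasFDerivAt (fun ψ => solutionDefect hσ.continuous x (v, ψ))
      (fderiv ℝ (solutionDefect hσ.continuous x) (v, φ) ∘L
        .inr ℝ (VelocitySpace d) (PathSpace F)) φ :=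
    ((contDiff_solutionDefect hσ x).differentiable one_ne_zero (v, φ)).hasFDerivAt.comp φ
      (hasFDerivAt_prodMk_right v φ)
  have h2 : HasFDerivAt (fun ψ => solutionDefect hσ.continuous x (v, ψ))
      (ContinuousLinearMap.id ℝ _ - ((volterra d F).flip v ∘L
        pathApply F _ (superpose (hσ.continuous_fderiv one_ne_zero) φ))) φ :=
    (hasFDerivAt_id φ).sub ((hasFDerivAt_volterra_superpose hσ v φ).const_add _)
  rw [h1.unique h2]
  exact isInvertible_of_bijective _ (bijective_sub_volterra_pathApply _ v)

/-- The implicit function theorem applies to `solutionDefect`. Global uniqueness of solutions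
identifies the local implicit function with the solution map. -/
theorem contDiff_solutionMap (hσ : ContDiff ℝ 1 σ) (hK : LipschitzWith K σ) (x : F) :
    ContDiff ℝ 1 (solutionMap hσ.continuous hK x : VelocitySpace d → _) := by
  rw [contDiff_iff_contDiffAt]
  intro v
  have hinv := isInvertible_fderiv_solutionDefect hσ x v (solutionMap hσ.continuous hK x v)
  have hcd := (contDiff_solutionDefect hσ x).contDiffAt
    (x := (v, solutionMap hσ.continuous hK x v))
  refine (hcd.contDiffAt_implicitFunction one_ne_zero hinv).congr_of_eventuallyEq ?_
  filter_upwards [hcd.eventually_apply_implicitFunction one_ne_zero hinv] with w hw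
  rw [(solutionDefect_eq_zero_iff hσ.continuous hK).mpr rfl,
    solutionDefect_eq_zero_iff hσ.continuous hK] at hw
  exact hw.symm

/-- The derivative of the solution map solves the linearised equation. -/
theorem fderiv_solutionMap_apply (hσ : ContDiff ℝ 1 σ) (hK : LipschitzWith K σ) (x : F)
    (v w : VelocitySpace d) :
    fderiv ℝ (solutionMap hσ.continuous hK x) v w =
      volterra d F (pathApply F _ (superpose (hσ.continuous_fderiv one_ne_zero)
        (solutionMap hσ.continuous hK x v)) (fderiv ℝ (solutionMap hσ.continuous hK x) v w)) v +
      volterra d F (superpose hσ.continuous (solutionMap hσ.continuous hK x v)) w := by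
  have hS : HasFDerivAt (solutionMap hσ.continuous hK x)
      (fderiv ℝ (solutionMap hσ.continuous hK x) v) v :=
    ((contDiff_solutionMap hσ hK x).differentiable one_ne_zero v).hasFDerivAt
  have h0 := (hasFDerivAt_superpose hσ (solutionMap hσ.continuous hK x v)).comp v hS
  have h1 := (ContinuousLinearMap.hasFDerivAt_of_bilinear (volterra d F) h0
    (hasFDerivAt_id v)).const_add (PathSpace.const x)
  have h4 := hS.unique (h1.congr_of_eventuallyEq
    (Filter.Eventually.of_forall fun v => solutionMap_eq hσ.continuous hK x v))
  have h5 := congrArg (fun A => A w) h4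
  rw [add_comm]
  exact h5

end SolutionMap

/-! ### The skeleton equation as a Volterra equation -/

section Skeleton

variable {n d : ℕ}

/-- The map `y ↦ (u ↦ ∑ᵢ uᵢ Vᵢ(y))`. -/
noncomputable def fieldMap (V : Fin d → EuclideanSpace ℝ (Fin n) → EuclideanSpace ℝ (Fin n))
    (y : EuclideanSpace ℝ (Fin n)) : EuclideanSpace ℝ (Fin d) →L[ℝ] EuclideanSpace ℝ (Fin n) :=
  ∑ i, (EuclideanSpace.proj i : EuclideanSpace ℝ (Fin d) →L[ℝ] ℝ).smulRight (V i y)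

variable {V : Fin d → EuclideanSpace ℝ (Fin n) → EuclideanSpace ℝ (Fin n)}

theorem fieldMap_apply (y : EuclideanSpace ℝ (Fin n)) (u : EuclideanSpace ℝ (Fin d)) :
    fieldMap V y u = ∑ i, u i • V i y := by
  simp [fieldMap, sum_apply]

theorem fieldMap_apply_single (y : EuclideanSpace ℝ (Fin n)) (i : Fin d) :
    fieldMap V y (EuclideanSpace.single i 1) = V i y := by
  simp [fieldMap_apply, Finset.sum_ite_eq', ite_smul]

theorem SmoothBoundedDerivatives.contDiff_fieldMap (hV : SmoothBoundedDerivatives V) :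
    ContDiff ℝ 1 (fieldMap V) := by
  refine ContDiff.sum fun i _ => ?_
  have h1 : ContDiff ℝ 1 (V i) := (hV i).1.of_le (by exact_mod_cast le_top)
  exact contDiff_const.smulRight h1

theorem SmoothBoundedDerivatives.exists_lipschitzWith (hV : SmoothBoundedDerivatives V)
    (i : Fin d) :
    ∃ K : NNReal, LipschitzWith K (V i) := by
  obtain ⟨C, hC⟩ := (hV i).2 1 le_rfl
  refine ⟨C.toNNReal, lipschitzWith_of_nnnorm_fderiv_le
    ((hV i).1.differentiable (by simp)) fun x => ?_⟩
  have h := hC x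
  rw [norm_iteratedFDeriv_one] at h
  rw [← NNReal.coe_le_coe, coe_nnnorm]
  exact h.trans (Real.le_coe_toNNReal C)

theorem SmoothBoundedDerivatives.exists_lipschitzWith_fieldMap (hV : SmoothBoundedDerivatives V) :
    ∃ K : NNReal, LipschitzWith K (fieldMap V) := by
  choose K hK using hV.exists_lipschitzWith
  refine ⟨∑ i, ‖(EuclideanSpace.proj i : EuclideanSpace ℝ (Fin d) →L[ℝ] ℝ)‖₊ * K i,
    LipschitzWith.of_dist_le_mul fun y z => ?_⟩
  rw [dist_eq_norm, fieldMap, fieldMap, ← Finset.sum_sub_distrib]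
  refine (norm_sum_le _ _).trans ?_
  push_cast
  rw [Finset.sum_mul]
  refine Finset.sum_le_sum fun i _ => ?_
  have h : (EuclideanSpace.proj i : EuclideanSpace ℝ (Fin d) →L[ℝ] ℝ).smulRight (V i y) -
      (EuclideanSpace.proj i : EuclideanSpace ℝ (Fin d) →L[ℝ] ℝ).smulRight (V i z) =
      (EuclideanSpace.proj i : EuclideanSpace ℝ (Fin d) →L[ℝ] ℝ).smulRight (V i y - V i z) := by
    ext1 u
    simp [smul_sub]
  rw [h, ContinuousLinearMap.norm_smulRight_apply, mul_assoc, ← dist_eq_norm]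
  exact mul_le_mul_of_nonneg_left ((hK i).dist_le_mul y z) (norm_nonneg _)

theorem isSkeletonSolution_IccExtend {hσ : Continuous (fieldMap V)} {x : EuclideanSpace ℝ (Fin n)}
    {h : CameronMartin d} {φ : PathSpace (EuclideanSpace ℝ (Fin n))}
    (hφ : φ = PathSpace.const x + volterra d _ (superpose hσ φ) (CameronMartin.velocity d h)) :
    IsSkeletonSolution V x h (IccExtend zero_le_one φ) := by
  refine ⟨(φ.continuous.Icc_extend').continuousOn, fun t ht => ?_⟩
  rw [IccExtend_of_mem _ _ ht]
  conv_lhs => rw [hφ]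
  rw [PathSpace.add_apply, PathSpace.const_apply, volterra_apply]
  congr 1
  refine intervalIntegral.integral_congr fun s _ => ?_
  exact fieldMap_apply _ _

theorem IsSkeletonSolution.eq_solutionMap (hσ : Continuous (fieldMap V)) {K : NNReal}
    (hK : LipschitzWith K (fieldMap V)) {x : EuclideanSpace ℝ (Fin n)} {h : CameronMartin d}
    {φ : ℝ → EuclideanSpace ℝ (Fin n)} (hφ : IsSkeletonSolution V x h φ) (t : unitInterval) :
    φ t = solutionMap hσ hK x (CameronMartin.velocity d h) t := by
  let ψ : PathSpace (EuclideanSpace ℝ (Fin n)) :=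
    .mk (fun t => φ t) (continuousOn_iff_continuous_domRestrict.mp hφ.1)
  have hψ : ψ = PathSpace.const x + volterra d _ (superpose hσ ψ)
      (CameronMartin.velocity d h) := by
    ext1 t
    rw [PathSpace.add_apply, PathSpace.const_apply, volterra_apply]
    refine (hφ.2 t t.2).trans ?_
    congr 1
    refine intervalIntegral.integral_congr fun s hs => ?_
    rw [uIcc_of_le t.2.1] at hs
    have hs' : s ∈ Icc (0 : ℝ) 1 := ⟨hs.1, hs.2.trans t.2.2⟩
    rw [IccExtend_of_mem _ _ hs']
    exact (fieldMap_apply _ _).symm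
  exact congrArg (fun ξ : PathSpace _ => ξ t) (_root_.eq_solutionMap hσ hK hψ)

theorem skeletonFlow_eq (hσ : Continuous (fieldMap V)) {K : NNReal}
    (hK : LipschitzWith K (fieldMap V)) (x : EuclideanSpace ℝ (Fin n)) (h : CameronMartin d)
    (t : unitInterval) :
    skeletonFlow V t x h = solutionMap hσ hK x (CameronMartin.velocity d h) t := by
  -- Existence rules out the default value `0` of `skeletonFlow`; uniqueness makes the choice of
  -- solution irrelevant.
  have hex : ∃ φ, IsSkeletonSolution V x h φ :=
    ⟨_, isSkeletonSolution_IccExtend (solutionMap_eq hσ hK x (CameronMartin.velocity d h))⟩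
  rw [skeletonFlow, dif_pos hex]
  exact hex.choose_spec.eq_solutionMap hσ hK t

theorem skeletonFlow_one (hσ : Continuous (fieldMap V)) {K : NNReal}
    (hK : LipschitzWith K (fieldMap V)) (x : EuclideanSpace ℝ (Fin n)) :
    (fun h : CameronMartin d => skeletonFlow V 1 x h) = fun h =>
      PathSpace.evalCLM 1 (solutionMap hσ hK x (CameronMartin.velocityIsometry d h)) := by
  funext h
  exact skeletonFlow_eq hσ hK x h 1

theorem contDiff_skeletonFlow_one (hV : SmoothBoundedDerivatives V)
    (x : EuclideanSpace ℝ (Fin n)) :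
    ContDiff ℝ 1 fun h : CameronMartin d => skeletonFlow V 1 x h := by
  obtain ⟨K, hK⟩ := hV.exists_lipschitzWith_fieldMap
  rw [skeletonFlow_one hV.contDiff_fieldMap.continuous hK]
  exact (ContinuousLinearMap.contDiff _).comp ((contDiff_solutionMap hV.contDiff_fieldMap hK x).comp
    (CameronMartin.velocityIsometry d).toContinuousLinearEquiv.contDiff)

theorem fderiv_skeletonFlow_one_apply (hV : SmoothBoundedDerivatives V) {K : NNReal}
    (hK : LipschitzWith K (fieldMap V)) (x : EuclideanSpace ℝ (Fin n)) (h k : CameronMartin d) :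
    fderiv ℝ (fun h : CameronMartin d => skeletonFlow V 1 x h) h k =
      fderiv ℝ (solutionMap hV.contDiff_fieldMap.continuous hK x) (CameronMartin.velocity d h)
        (CameronMartin.velocity d k) 1 := by
  have h1 : HasFDerivAt (solutionMap hV.contDiff_fieldMap.continuous hK x) _
      (CameronMartin.velocityIsometry d h) :=
    ((contDiff_solutionMap hV.contDiff_fieldMap hK x).differentiable one_ne_zero _).hasFDerivAt
  have h2 := (ContinuousLinearMap.hasFDerivAt
    (PathSpace.evalCLM (F := EuclideanSpace ℝ (Fin n)) 1)).comp h
    (h1.comp h (CameronMartin.velocityIsometry d).toContinuousLinearEquiv.hasFDerivAt)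
  rw [skeletonFlow_one hV.contDiff_fieldMap.continuous hK]
  have h3 := h2.fderiv
  exact congrArg (fun A => A k) h3

end Skeleton

/-! ### Disjoint measurable sets charging every interval -/

section RoughPartition

/-- The rationals are null, so they have open neighbourhoods of arbitrarily small measure; `U` is
intersected with one of these. -/
theorem exists_isOpen_dense_subset_volume_lt {U : Set ℝ} (hU : IsOpen U) (hd : Dense U)
    {ε : ENNReal} (hε : 0 < ε) : ∃ U' ⊆ U, IsOpen U' ∧ Dense U' ∧ volume U' < ε := by
  have h0 : volume (range ((↑) : ℚ → ℝ)) < ε := by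
    rwa [(countable_range _).measure_zero]
  obtain ⟨O, hO, hOo, hOlt⟩ := exists_isOpen_lt_of_lt _ _ h0
  refine ⟨U ∩ O, inter_subset_left, hU.inter hOo, ?_,
    (measure_mono inter_subset_right).trans_lt hOlt⟩
  exact hd.inter_of_isOpen_right (Dense.mono hO Rat.denseRange_cast) hOo

/-- There are countably many pairwise disjoint measurable sets such that every open interval meets
all but finitely many of them in positive measure. -/
theorem exists_pairwise_disjoint_eventually_volume_pos :
    ∃ D : ℕ → Set ℝ, (∀ m, MeasurableSet (D m)) ∧ Pairwise (Function.onFun Disjoint D) ∧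
      ∀ a b : ℝ, a < b → ∃ k, ∀ m ≥ k, 0 < volume (D m ∩ Ioo a b) := by
  obtain ⟨I, hI⟩ := (TopologicalSpace.countable_countableBasis ℝ).exists_eq_range
    (let ⟨B, hB, _⟩ := (TopologicalSpace.isBasis_countableBasis ℝ).exists_subset_of_mem_open
      (mem_univ 0) isOpen_univ; ⟨B, hB⟩)
  have hImem : ∀ k, I k ∈ TopologicalSpace.countableBasis ℝ := fun k => hI ▸ mem_range_self k
  have hIo : ∀ k, IsOpen (I k) := fun k => TopologicalSpace.isOpen_of_mem_countableBasis (hImem k)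
  have hIn : ∀ k, (I k).Nonempty := fun k =>
    TopologicalSpace.nonempty_of_mem_countableBasis (hImem k)
  -- A decreasing sequence of dense open sets is built, the next one having less measure than the
  -- current one has inside each of the first `m + 1` basic open sets. The differences of
  -- consecutive sets then charge `I k` from index `k` on.
  have step : ∀ (m : ℕ) (U : {U : Set ℝ // IsOpen U ∧ Dense U}),
      ∃ U' : {U : Set ℝ // IsOpen U ∧ Dense U}, U'.1 ⊆ U.1 ∧
        ∀ k ≤ m, volume U'.1 < volume (I k ∩ U.1) := by
    rintro m ⟨U, hU, hd⟩
    have hpos : 0 < (Finset.range (m + 1)).inf' Finset.nonempty_range_add_one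
        fun k => volume (I k ∩ U) := by
      rw [Finset.lt_inf'_iff]
      exact fun k _ => ((hIo k).inter hU).measure_pos _ (hd.inter_open_nonempty _ (hIo k) (hIn k))
    obtain ⟨U', hsub, ho, hd', hlt⟩ := exists_isOpen_dense_subset_volume_lt hU hd hpos
    refine ⟨⟨U', ho, hd'⟩, hsub, fun k hk => ?_⟩
    rw [Finset.lt_inf'_iff] at hlt
    exact hlt k (Finset.mem_range.mpr (Nat.lt_succ_of_le hk))
  choose next hnext hlt using step
  let U : ℕ → {U : Set ℝ // IsOpen U ∧ Dense U} := fun m =>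
    Nat.rec ⟨univ, isOpen_univ, dense_univ⟩ next m
  have hUs : ∀ m, U (m + 1) = next m (U m) := fun _ => rfl
  have hanti : Antitone fun m => (U m).1 := antitone_nat_of_succ_le fun m => by
    rw [hUs]
    exact hnext m (U m)
  refine ⟨fun m => (U m).1 \ (U (m + 1)).1,
    fun m => (U m).2.1.measurableSet.diff (U (m + 1)).2.1.measurableSet, ?_, ?_⟩
  · rw [pairwise_disjoint_on]
    intro m m' hm
    refine disjoint_left.mpr fun s hs hs' => hs.2 ?_
    exact hanti (Nat.succ_le_of_lt hm) hs'.1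
  · intro a b hab
    obtain ⟨c, hc⟩ := nonempty_Ioo.mpr hab
    obtain ⟨B, hB, hcB, hBsub⟩ :=
      (TopologicalSpace.isBasis_countableBasis ℝ).exists_subset_of_mem_open hc isOpen_Ioo
    rw [hI] at hB
    obtain ⟨k, rfl⟩ := hB
    refine ⟨k, fun m hm => ?_⟩
    have h1 : 0 < volume ((I k ∩ (U m).1) \ (U (m + 1)).1) := by
      refine lt_of_lt_of_le (tsub_pos_of_lt ?_) le_measure_sdiff
      rw [hUs]
      exact hlt m (U m) k hm
    refine h1.trans_le (measure_mono ?_)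
    rintro s ⟨⟨hs1, hs2⟩, hs3⟩
    exact ⟨⟨hs2, hs3⟩, hBsub hs1⟩

/-- There are `d` pairwise disjoint measurable sets each of which meets every open interval in
positive measure. -/
theorem exists_pairwise_disjoint_volume_pos (d : ℕ) :
    ∃ A : Fin d → Set ℝ, (∀ j, MeasurableSet (A j)) ∧ Pairwise (Function.onFun Disjoint A) ∧
      ∀ (j : Fin d) (a b : ℝ), a < b → 0 < volume (A j ∩ Ioo a b) := by
  obtain ⟨D, hD, hdisj, hpos⟩ := exists_pairwise_disjoint_eventually_volume_pos
  -- The indices are split by residue modulo `d`; each class contains arbitrarily large indices.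
  refine ⟨fun j => ⋃ m, D (m * d + j), fun j => MeasurableSet.iUnion fun m => hD _, ?_, ?_⟩
  · intro i j hij
    refine disjoint_iUnion_left.mpr fun m => disjoint_iUnion_right.mpr fun m' => hdisj ?_
    intro h
    apply hij
    have h1 := congrArg (· % d) h
    simp only [Nat.mul_add_mod_self_right, Nat.mod_eq_of_lt i.2, Nat.mod_eq_of_lt j.2] at h1
    exact Fin.ext h1
  · intro j a b hab
    obtain ⟨k, hk⟩ := hpos a b hab
    have hd : 0 < d := j.pos
    refine (hk (k * d + j) ?_).trans_le (measure_mono ?_)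
    · exact (Nat.le_mul_of_pos_right k hd).trans (Nat.le_add_right _ _)
    · exact inter_subset_inter_left _ (subset_iUnion (fun m => D (m * d + j)) k)

/-- The function equal to the `j`-th basis vector on `A j`, and to `0` off `⋃ j, A j`. -/
noncomputable def stepControl {d : ℕ} (A : Fin d → Set ℝ) (s : ℝ) : EuclideanSpace ℝ (Fin d) :=
  ∑ j, (A j).indicator (fun _ => EuclideanSpace.single j (1 : ℝ)) s

theorem stepControl_of_mem {d : ℕ} {A : Fin d → Set ℝ} (hA : Pairwise (Function.onFun Disjoint A))
    {j : Fin d} {s : ℝ} (hs : s ∈ A j) : stepControl A s = EuclideanSpace.single j 1 := by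
  rw [stepControl, Finset.sum_eq_single j, indicator_of_mem hs]
  · intro i _ hij
    exact indicator_of_notMem (disjoint_right.mp (hA hij) hs) _
  · simp

theorem measurable_stepControl {d : ℕ} {A : Fin d → Set ℝ} (hA : ∀ j, MeasurableSet (A j)) :
    Measurable (stepControl A) := by
  unfold stepControl
  exact Finset.measurable_fun_sum _ fun j _ => measurable_const.indicator (hA j)

theorem norm_stepControl_le {d : ℕ} {A : Fin d → Set ℝ} (s : ℝ) : ‖stepControl A s‖ ≤ d := by
  refine (norm_sum_le _ _).trans ((Finset.sum_le_card_nsmul _ _ 1 fun j _ => ?_).trans (by simp))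
  refine (norm_indicator_le_norm_self _ _).trans ?_
  simp

end RoughPartition

/-! ### Product rule and almost-everywhere derivatives for primitives -/

section Primitives

theorem absolutelyContinuousOnInterval_const_add_integral {a : ℝ → ℝ} (c : ℝ)
    (ha : IntervalIntegrable a volume 0 1) :
    AbsolutelyContinuousOnInterval (fun t => c + ∫ s in (0 : ℝ)..t, a s) 0 1 := by
  have h1 : AbsolutelyContinuousOnInterval (fun _ : ℝ => c) 0 1 :=
    (LipschitzWith.const c).lipschitzOnWith.absolutelyContinuousOnInterval
  exact h1.add (ha.absolutelyContinuousOnInterval_intervalIntegral left_mem_uIcc)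

theorem mul_sub_mul_eq_integral {a b : ℝ → ℝ} (c c' : ℝ)
    (ha : IntervalIntegrable a volume 0 1) (hb : IntervalIntegrable b volume 0 1) :
    (c + ∫ s in (0 : ℝ)..1, a s) * (c' + ∫ s in (0 : ℝ)..1, b s) - c * c' =
      ∫ t in (0 : ℝ)..1, (a t * (c' + ∫ s in (0 : ℝ)..t, b s) +
        (c + ∫ s in (0 : ℝ)..t, a s) * b t) := by
  have h := (absolutelyContinuousOnInterval_const_add_integral c ha).integral_deriv_mul_eq_sub
    (absolutelyContinuousOnInterval_const_add_integral c' hb)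
  simp only [intervalIntegral.integral_same, add_zero] at h
  rw [← h]
  refine intervalIntegral.integral_congr_ae ?_
  filter_upwards [ha.ae_hasDerivAt_integral, hb.ae_hasDerivAt_integral] with t hat hbt ht
  have ht' := uIoc_subset_uIcc ht
  rw [((hat ht' 0 left_mem_uIcc).const_add c).deriv, ((hbt ht' 0 left_mem_uIcc).const_add c').deriv]

/-- The integral of the derivative of the inner product of two absolutely continuous paths. -/
theorem inner_sub_inner_eq_integral {n : ℕ} {a b : ℝ → EuclideanSpace ℝ (Fin n)}
    (c c' : EuclideanSpace ℝ (Fin n))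
    (ha : IntervalIntegrable a volume 0 1) (hb : IntervalIntegrable b volume 0 1)
    {α β : ℝ → EuclideanSpace ℝ (Fin n)}
    (hα : ∀ t ∈ Icc (0 : ℝ) 1, α t = c + ∫ s in (0 : ℝ)..t, a s)
    (hβ : ∀ t ∈ Icc (0 : ℝ) 1, β t = c' + ∫ s in (0 : ℝ)..t, b s) :
    ⟪α 1, β 1⟫_ℝ - ⟪c, c'⟫_ℝ = ∫ t in (0 : ℝ)..1, (⟪a t, β t⟫_ℝ + ⟪α t, b t⟫_ℝ) := by
  have hcoord : ∀ {f : ℝ → EuclideanSpace ℝ (Fin n)} (hf : IntervalIntegrable f volume 0 1)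
      (i : Fin n), IntervalIntegrable (fun t => f t i) volume 0 1 := fun hf i =>
    ⟨(EuclideanSpace.proj (𝕜 := ℝ) i).integrable_comp hf.1,
      (EuclideanSpace.proj (𝕜 := ℝ) i).integrable_comp hf.2⟩
  have hint : ∀ {f : ℝ → EuclideanSpace ℝ (Fin n)} (hf : IntervalIntegrable f volume 0 1)
      (i : Fin n) {t : ℝ}, t ∈ Icc (0 : ℝ) 1 →
      (∫ s in (0 : ℝ)..t, f s) i = ∫ s in (0 : ℝ)..t, f s i := fun hf i t ht =>
    ((EuclideanSpace.proj (𝕜 := ℝ) i).intervalIntegral_comp_comm (hf.mono_set (by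
      rw [uIcc_of_le ht.1, uIcc_of_le zero_le_one]; exact Icc_subset_Icc_right ht.2))).symm
  have hαi : ∀ i, ∀ t ∈ Icc (0 : ℝ) 1, α t i = c i + ∫ s in (0 : ℝ)..t, a s i := fun i t ht => by
    rw [hα t ht, PiLp.add_apply, hint ha i ht]
  have hβi : ∀ i, ∀ t ∈ Icc (0 : ℝ) 1, β t i = c' i + ∫ s in (0 : ℝ)..t, b s i := fun i t ht => by
    rw [hβ t ht, PiLp.add_apply, hint hb i ht]
  have hsum : ∀ u w : EuclideanSpace ℝ (Fin n), ⟪u, w⟫_ℝ = ∑ i, u i * w i := fun u w => by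
    simp [PiLp.inner_apply, mul_comm]
  simp only [hsum]
  have h1 : (1 : ℝ) ∈ Icc (0 : ℝ) 1 := ⟨zero_le_one, le_rfl⟩
  have hαc : ∀ i, ContinuousOn (fun t => α t i) (uIcc 0 1) := fun i =>
    (absolutelyContinuousOnInterval_const_add_integral (c i) (hcoord ha i)).continuousOn.congr
      fun t ht => hαi i t (by rwa [uIcc_of_le zero_le_one] at ht)
  have hβc : ∀ i, ContinuousOn (fun t => β t i) (uIcc 0 1) := fun i =>
    (absolutelyContinuousOnInterval_const_add_integral (c' i) (hcoord hb i)).continuousOn.congr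
      fun t ht => hβi i t (by rwa [uIcc_of_le zero_le_one] at ht)
  rw [← Finset.sum_sub_distrib]
  simp only [← Finset.sum_add_distrib]
  rw [intervalIntegral.integral_finsetSum fun i _ =>
    ((hcoord ha i).mul_continuousOn (hβc i)).add ((hcoord hb i).continuousOn_mul (hαc i))]
  refine Finset.sum_congr rfl fun i _ => ?_
  rw [hαi i 1 h1, hβi i 1 h1, mul_sub_mul_eq_integral _ _ (hcoord ha i) (hcoord hb i)]
  refine intervalIntegral.integral_congr fun t ht => ?_
  rw [uIcc_of_le zero_le_one] at ht
  simp only [hαi i t ht, hβi i t ht]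

variable {d : ℕ} {F : Type*} [NormedAddCommGroup F] [NormedSpace ℝ F] [CompleteSpace F]

theorem ae_hasDerivAt_of_eq_const_add_volterra {φ : PathSpace F} {x : F}
    {z : PathSpace (EuclideanSpace ℝ (Fin d) →L[ℝ] F)} {v : VelocitySpace d}
    (h : φ = PathSpace.const x + volterra d F z v) :
    ∀ᵐ s : ℝ, s ∈ Ioo (0 : ℝ) 1 →
      HasDerivAt (IccExtend zero_le_one φ) (IccExtend zero_le_one z s (v s)) s := by
  have hi := intervalIntegrable_extend_apply z v (left_mem_Icc.mpr zero_le_one)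
    (right_mem_Icc.mpr zero_le_one)
  filter_upwards [hi.ae_hasDerivAt_integral] with s hs hs01
  have h1 := (hs (by rw [uIcc_of_le zero_le_one]; exact Ioo_subset_Icc_self hs01) 0
    left_mem_uIcc).const_add x
  refine h1.congr_of_eventuallyEq ?_
  filter_upwards [Ioo_mem_nhds hs01.1 hs01.2] with t ht
  rw [IccExtend_of_mem _ _ (Ioo_subset_Icc_self ht)]
  conv_lhs => rw [h]
  rfl

end Primitives

/-! ### The adjoint equation and duality -/

section Adjoint

variable {n d : ℕ} {V : Fin d → EuclideanSpace ℝ (Fin n) → EuclideanSpace ℝ (Fin n)}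

theorem fderiv_fieldMap_apply (hV : ∀ i, ContDiff ℝ 1 (V i)) (y z : EuclideanSpace ℝ (Fin n))
    (u : EuclideanSpace ℝ (Fin d)) :
    fderiv ℝ (fieldMap V) y z u = ∑ i, u i • fderiv ℝ (V i) y z := by
  have h1 : ContDiff ℝ 1 (fieldMap V) :=
    ContDiff.sum fun i _ => contDiff_const.smulRight (hV i)
  have h2 := ((h1.differentiable one_ne_zero y).hasFDerivAt.clm_apply (hasFDerivAt_const u y))
  have h3 : HasFDerivAt (fun y => fieldMap V y u) (∑ i, u i • fderiv ℝ (V i) y) y := by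
    simp only [fieldMap_apply]
    exact HasFDerivAt.fun_sum fun i _ =>
      (((hV i).differentiable one_ne_zero y).hasFDerivAt.const_smul (u i))
  have h4 := congrArg (fun A => A z) (h2.unique h3)
  simpa [sum_apply] using h4

/-- The coefficient of the adjoint equation: `u ↦ -∑ᵢ uᵢ DVᵢ(y)† z`. -/
noncomputable def adjointField (V : Fin d → EuclideanSpace ℝ (Fin n) → EuclideanSpace ℝ (Fin n))
    (y z : EuclideanSpace ℝ (Fin n)) :
    EuclideanSpace ℝ (Fin d) →L[ℝ] EuclideanSpace ℝ (Fin n) :=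
  -∑ i, (EuclideanSpace.proj i : EuclideanSpace ℝ (Fin d) →L[ℝ] ℝ).smulRight
    (ContinuousLinearMap.adjoint (fderiv ℝ (V i) y) z)

theorem adjointField_apply (y z : EuclideanSpace ℝ (Fin n)) (u : EuclideanSpace ℝ (Fin d)) :
    adjointField V y z u = -∑ i, u i • ContinuousLinearMap.adjoint (fderiv ℝ (V i) y) z := by
  simp [adjointField, sum_apply]

theorem adjointField_sub (y z z' : EuclideanSpace ℝ (Fin n)) :
    adjointField V y (z - z') = adjointField V y z - adjointField V y z' := by
  ext1 u
  simp only [sub_apply, adjointField_apply, map_sub, smul_sub, Finset.sum_sub_distrib]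
  abel

theorem adjointField_add_smul (y z z' : EuclideanSpace ℝ (Fin n)) (c : ℝ) :
    adjointField V y (z + c • z') = adjointField V y z + c • adjointField V y z' := by
  ext1 u
  simp only [add_apply, smul_apply, adjointField_apply, map_add, map_smul, smul_add,
    Finset.sum_add_distrib, neg_add, smul_neg, Finset.smul_sum]
  congr 2
  exact Finset.sum_congr rfl fun i _ => smul_comm _ _ _

/-- The `DV_i` are bounded uniformly in `y`, so the adjoint equation is globally Lipschitz along any
path. -/
theorem norm_adjointField_le (hV : SmoothBoundedDerivatives V) :
    ∃ K : ℝ, ∀ y z : EuclideanSpace ℝ (Fin n), ‖adjointField V y z‖ ≤ K * ‖z‖ := by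
  choose K hK using hV.exists_lipschitzWith
  refine ⟨∑ i, ‖(EuclideanSpace.proj i : EuclideanSpace ℝ (Fin d) →L[ℝ] ℝ)‖ * K i, fun y z => ?_⟩
  rw [adjointField, norm_neg, Finset.sum_mul]
  refine (norm_sum_le _ _).trans (Finset.sum_le_sum fun i _ => ?_)
  rw [ContinuousLinearMap.norm_smulRight_apply, mul_assoc]
  refine mul_le_mul_of_nonneg_left ((ContinuousLinearMap.le_opNorm _ _).trans ?_) (norm_nonneg _)
  rw [LinearIsometryEquiv.norm_map]
  exact mul_le_mul_of_nonneg_right (norm_fderiv_le_of_lipschitz ℝ (hK i)) (norm_nonneg _)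

theorem continuous_adjointField (hV : ∀ i, ContDiff ℝ 1 (V i))
    (φ q : PathSpace (EuclideanSpace ℝ (Fin n))) :
    Continuous fun t => adjointField V (φ t) (q t) := by
  refine (continuous_finsetSum _ fun i _ => ?_).neg
  have h1 : Continuous fun t : unitInterval =>
      ContinuousLinearMap.adjoint (fderiv ℝ (V i) (φ t)) :=
    (LinearIsometryEquiv.continuous _).comp
      (((hV i).continuous_fderiv one_ne_zero).comp φ.continuous)
  exact (ContinuousLinearMap.smulRightL ℝ (EuclideanSpace ℝ (Fin d)) (EuclideanSpace ℝ (Fin n))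
    (EuclideanSpace.proj i)).continuous.comp (h1.clm_apply q.continuous)

/-- The path `t ↦ adjointField V (φ t) (q t)`. -/
noncomputable def adjointPath (hV : ∀ i, ContDiff ℝ 1 (V i))
    (φ q : PathSpace (EuclideanSpace ℝ (Fin n))) :
    PathSpace (EuclideanSpace ℝ (Fin d) →L[ℝ] EuclideanSpace ℝ (Fin n)) :=
  .mk (fun t => adjointField V (φ t) (q t)) (continuous_adjointField hV φ q)

/-- The adjoint equation has a unique solution for each initial value, and it depends linearly on
the initial value. -/
theorem exists_linearMap_adjoint_solution (hV : SmoothBoundedDerivatives V)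
    (hV1 : ∀ i, ContDiff ℝ 1 (V i)) (φ : PathSpace (EuclideanSpace ℝ (Fin n)))
    (v : VelocitySpace d) :
    ∃ Q : EuclideanSpace ℝ (Fin n) →ₗ[ℝ] PathSpace (EuclideanSpace ℝ (Fin n)),
      ∀ p, Q p = PathSpace.const p + volterra d _ (adjointPath hV1 φ (Q p)) v := by
  obtain ⟨K, hK⟩ := norm_adjointField_le hV
  have huniq := fun f => existsUnique_eq_add_volterra (adjointPath hV1 φ) (K := K)
    (fun q q' s => by
      change ‖adjointField V (φ s) (q s) - adjointField V (φ s) (q' s)‖ ≤ _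
      rw [← adjointField_sub]
      exact hK _ _) f v
  choose Q hQ hQu using fun p => huniq (PathSpace.const p)
  -- Both sides solve the same equation with the same initial value, so uniqueness gives linearity.
  have hlin : ∀ (c : ℝ) p p', Q (p + c • p') = Q p + c • Q p' := by
    intro c p p'
    refine (hQu (p + c • p') _ ?_).symm
    have hadj : adjointPath hV1 φ (Q p + c • Q p') =
        adjointPath hV1 φ (Q p) + c • adjointPath hV1 φ (Q p') := by
      ext1 t
      exact adjointField_add_smul _ _ _ _
    have hc : PathSpace.const (p + c • p') = PathSpace.const p + c • PathSpace.const p' := rfl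
    change _ = _
    conv_lhs => rw [hQ p, hQ p']
    rw [hadj, hc, map_add, map_smul, add_apply, smul_apply, smul_add]
    abel
  have h0 : Q 0 = 0 := by
    have := hlin 1 0 0
    simpa using this
  exact ⟨{
    toFun := Q
    map_add' := fun p p' => by simpa using hlin 1 p p'
    map_smul' := fun c p => by simpa [h0] using hlin c 0 p }, hQ⟩

/-- The duality between the linearised equation and the adjoint equation. -/
theorem inner_adjoint_eq_integral (hV1 : ∀ i, ContDiff ℝ 1 (V i)) (hσ : ContDiff ℝ 1 (fieldMap V))
    {φ q ξ : PathSpace (EuclideanSpace ℝ (Fin n))} {v w : VelocitySpace d}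
    {p : EuclideanSpace ℝ (Fin n)}
    (hq : q = PathSpace.const p + volterra d _ (adjointPath hV1 φ q) v)
    (hξ : ξ = volterra d _ (pathApply _ _ (superpose (hσ.continuous_fderiv one_ne_zero) φ) ξ) v +
      volterra d _ (superpose hσ.continuous φ) w) :
    ⟪q 1, ξ 1⟫_ℝ = ∫ s in (0 : ℝ)..1, ⟪IccExtend zero_le_one q s,
      fieldMap V (IccExtend zero_le_one φ s) (w s)⟫_ℝ := by
  have hI : ∀ z : PathSpace (EuclideanSpace ℝ (Fin d) →L[ℝ] EuclideanSpace ℝ (Fin n)),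
      ∀ v : VelocitySpace d, IntervalIntegrable (fun s => IccExtend zero_le_one z s (v s))
        volume 0 1 := fun z v => intervalIntegrable_extend_apply z v
          (left_mem_Icc.mpr zero_le_one) (right_mem_Icc.mpr zero_le_one)
  have hI' : ∀ z : PathSpace (EuclideanSpace ℝ (Fin d) →L[ℝ] EuclideanSpace ℝ (Fin n)),
      ∀ v : VelocitySpace d, ∀ t ∈ Icc (0 : ℝ) 1,
        IntervalIntegrable (fun s => IccExtend zero_le_one z s (v s)) volume 0 t := fun z v t ht =>
    intervalIntegrable_extend_apply z v (left_mem_Icc.mpr zero_le_one) ht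
  have h := inner_sub_inner_eq_integral p 0 (hI (adjointPath hV1 φ q) v)
    ((hI (pathApply _ _ (superpose (hσ.continuous_fderiv one_ne_zero) φ) ξ) v).add
      (hI (superpose hσ.continuous φ) w))
    (α := IccExtend zero_le_one q) (β := IccExtend zero_le_one ξ)
    (fun t ht => by
      rw [IccExtend_of_mem _ _ ht]
      conv_lhs => rw [hq]
      rfl)
    (fun t ht => by
      rw [IccExtend_of_mem _ _ ht, zero_add, intervalIntegral.integral_add (hI' _ _ t ht)
        (hI' _ _ t ht)]
      conv_lhs => rw [hξ]
      rfl)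
  rw [inner_zero_right, sub_zero, IccExtend_right, IccExtend_right] at h
  refine h.trans (intervalIntegral.integral_congr fun s hs => ?_)
  rw [uIcc_of_le zero_le_one] at hs
  simp only [IccExtend_of_mem _ _ hs]
  change ⟪adjointField V (φ ⟨s, hs⟩) (q ⟨s, hs⟩) (v s), _⟫_ℝ +
    ⟪_, fderiv ℝ (fieldMap V) (φ ⟨s, hs⟩) (ξ ⟨s, hs⟩) (v s) + fieldMap V (φ ⟨s, hs⟩) (w s)⟫_ℝ = _
  -- The adjoint coefficient is chosen to cancel the linearised term driven by `v`; only the forcing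
  -- by `w` survives.
  rw [inner_add_right, ← add_assoc, add_eq_right, adjointField_apply, fderiv_fieldMap_apply hV1,
    inner_neg_left, sum_inner, inner_sum, neg_add_eq_zero]
  refine Finset.sum_congr rfl fun i _ => ?_
  rw [inner_smul_left, inner_smul_right, ContinuousLinearMap.adjoint_inner_left]
  rfl

end Adjoint

/-! ### Propagation of orthogonality to the iterated brackets -/

section Bracket

variable {n d : ℕ} {V : Fin d → EuclideanSpace ℝ (Fin n) → EuclideanSpace ℝ (Fin n)}

/-- Testing against `w = f e_i`, where `f` is the inner product in question, gives `∫ f² = 0`;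
continuity of `f` removes the exceptional null set. -/
theorem inner_field_eq_zero_of_forall_integral_eq_zero (hV : ∀ i, Continuous (V i))
    {φ q : PathSpace (EuclideanSpace ℝ (Fin n))}
    (h : ∀ w : VelocitySpace d, ∫ s in (0 : ℝ)..1, ⟪IccExtend zero_le_one q s,
      fieldMap V (IccExtend zero_le_one φ s) (w s)⟫_ℝ = 0) (i : Fin d) :
    ∀ t ∈ Icc (0 : ℝ) 1,
      ⟪IccExtend zero_le_one q t, V i (IccExtend zero_le_one φ t)⟫_ℝ = 0 := by
  set f : ℝ → ℝ := fun t => ⟪IccExtend zero_le_one q t, V i (IccExtend zero_le_one φ t)⟫_ℝ with hf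
  have hfc : Continuous f :=
    (q.continuous.Icc_extend').inner ((hV i).comp φ.continuous.Icc_extend')
  have hgc : Continuous fun t =>
      f t • (EuclideanSpace.single i (1 : ℝ) : EuclideanSpace ℝ (Fin d)) :=
    hfc.smul continuous_const
  obtain ⟨C, hC⟩ := (isCompact_Icc (a := (0 : ℝ)) (b := 1)).exists_bound_of_continuousOn
    hgc.continuousOn
  have hg : MemLp (fun t => f t • (EuclideanSpace.single i (1 : ℝ) : EuclideanSpace ℝ (Fin d))) 2
      ((volume : Measure ℝ).restrict (Icc (0 : ℝ) 1)) := by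
    refine MemLp.of_bound hgc.aestronglyMeasurable C ?_
    filter_upwards [ae_restrict_mem measurableSet_Icc] with s hs using hC s hs
  have h1 : ∫ s in (0 : ℝ)..1, f s ^ 2 = 0 := by
    refine Eq.trans ?_ (h (MemLp.toLp _ hg))
    refine intervalIntegral.integral_congr_ae ?_
    refine ae_restrict_uIoc_of_ae_Icc (right_mem_Icc.mpr zero_le_one) ?_
    filter_upwards [hg.coeFn_toLp] with s hs
    rw [hs, map_smul, fieldMap_apply_single, inner_smul_right, sq]
  rw [intervalIntegral.integral_of_le zero_le_one, ← integral_Icc_eq_integral_Ioc,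
    integral_eq_zero_iff_of_nonneg (fun s => sq_nonneg (f s))
      ((hfc.pow 2).continuousOn.integrableOn_compact isCompact_Icc)] at h1
  have h2 := Measure.eqOn_Icc_of_ae_eq (μ := volume) zero_ne_one h1
    (hfc.pow 2).continuousOn continuousOn_const
  intro t ht
  exact pow_eq_zero_iff two_ne_zero |>.mp (h2 ht)

theorem contDiff_of_mem_bracketSet (hV : ∀ i, ContDiff ℝ ∞ (V i)) (k : ℕ) :
    ∀ W ∈ bracketSet V k, ContDiff ℝ ∞ W := by
  induction k with
  | zero =>
    rintro _ ⟨i, rfl⟩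
    exact hV i
  | succ k ih =>
    rintro _ ⟨i, W, hW, rfl⟩
    exact (hV i).lieBracket_vectorField (ih W hW) (by simp)

/-- The chain rule contributes `⟪q, DW V_j⟫` and the adjoint equation `-⟪q, DV_j W⟫`; together they
form the bracket. -/
theorem hasDerivAt_inner_field {q φ : ℝ → EuclideanSpace ℝ (Fin n)}
    {W : EuclideanSpace ℝ (Fin n) → EuclideanSpace ℝ (Fin n)} (hW : ContDiff ℝ ∞ W) {s : ℝ}
    {j : Fin d} (hq : HasDerivAt q (adjointField V (φ s) (q s) (EuclideanSpace.single j 1)) s)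
    (hφ : HasDerivAt φ (fieldMap V (φ s) (EuclideanSpace.single j 1)) s) :
    HasDerivAt (fun t => ⟪q t, W (φ t)⟫_ℝ)
      ⟪q s, VectorField.lieBracket ℝ (V j) W (φ s)⟫_ℝ s := by
  have hWφ : HasDerivAt (fun t => W (φ t)) (fderiv ℝ W (φ s) (V j (φ s))) s := by
    have h := (hW.differentiable (by simp) (φ s)).hasFDerivAt.comp_hasDerivAt s hφ
    rwa [fieldMap_apply_single] at h
  refine (hq.inner ℝ hWφ).congr_deriv ?_
  symm
  rw [adjointField_apply, Finset.sum_eq_single j]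
  · simp only [PiLp.single_apply, if_true, one_smul, inner_neg_left,
      ContinuousLinearMap.adjoint_inner_left]
    rw [VectorField.lieBracket_eq, inner_sub_right, sub_eq_add_neg]
  · intro i _ hij
    simp [hij]
  · simp

/-- Removing a null set from `A` leaves a set dense in every interval, and the zero set of `f` is
closed. -/
theorem eqOn_zero_of_ae_eq_zero_on {A : Set ℝ} (hA : ∀ a b : ℝ, a < b → 0 < volume (A ∩ Ioo a b))
    {f : ℝ → ℝ} (hf : Continuous f) {δ : ℝ} (hδ : 0 < δ)
    (h : ∀ᵐ s, s ∈ A → s ∈ Ioo 0 δ → f s = 0) : ∀ t ∈ Icc 0 δ, f t = 0 := by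
  have hclosed : IsClosed {t | f t = 0} := isClosed_eq hf continuous_const
  have hsub : Ioo 0 δ ⊆ {t | f t = 0} := by
    intro t ht
    refine hclosed.closure_subset (mem_closure_iff_nhds.mpr fun N hN => ?_)
    obtain ⟨a, b, hab, hsub⟩ := mem_nhds_iff_exists_Ioo_subset.mp
      (Filter.inter_mem hN (Ioo_mem_nhds ht.1 ht.2))
    obtain ⟨s, hs, hs'⟩ : ∃ s ∈ A ∩ Ioo a b, s ∈ A → s ∈ Ioo 0 δ → f s = 0 := by
      by_contra! hcon
      refine (hA a b (hab.1.trans hab.2)).ne' (measure_mono_null (fun s hs => ?_) (ae_iff.mp h))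
      obtain ⟨h1, h2, h3⟩ := hcon s hs
      exact fun h => h3 (h h1 h2)
    exact ⟨s, (hsub hs.2).1, hs' hs.1 (hsub hs.2).2⟩
  intro t ht
  rw [← closure_Ioo hδ.ne] at ht
  exact closure_minimal hsub hclosed ht

/-- If the adjoint path annihilates the fields `Vᵢ` along the solution driven by a step control
with everywhere-dense level sets, then it annihilates all the iterated brackets. -/
theorem inner_bracket_eq_zero (hV : ∀ i, ContDiff ℝ ∞ (V i)) (hV1 : ∀ i, ContDiff ℝ 1 (V i))
    (hσ : Continuous (fieldMap V)) {φ q : PathSpace (EuclideanSpace ℝ (Fin n))}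
    {v : VelocitySpace d} {x p : EuclideanSpace ℝ (Fin n)}
    (hφ : φ = PathSpace.const x + volterra d _ (superpose hσ φ) v)
    (hq : q = PathSpace.const p + volterra d _ (adjointPath hV1 φ q) v)
    {A : Fin d → Set ℝ} (hA : ∀ (j : Fin d) (a b : ℝ), a < b → 0 < volume (A j ∩ Ioo a b))
    {δ : ℝ} (hδ : 0 < δ) (hδ1 : δ ≤ 1)
    (hv : ∀ j, ∀ᵐ s, s ∈ A j → s ∈ Ioo 0 δ → v s = EuclideanSpace.single j 1)
    (h0 : ∀ i, ∀ t ∈ Icc (0 : ℝ) δ,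
      ⟪IccExtend zero_le_one q t, V i (IccExtend zero_le_one φ t)⟫_ℝ = 0) (k : ℕ) :
    ∀ W ∈ bracketSet V k, ∀ t ∈ Icc (0 : ℝ) δ,
      ⟪IccExtend zero_le_one q t, W (IccExtend zero_le_one φ t)⟫_ℝ = 0 := by
  induction k with
  | zero =>
    rintro _ ⟨i, rfl⟩
    exact h0 i
  | succ k ih =>
    rintro _ ⟨j, W, hW, rfl⟩
    have hWs := contDiff_of_mem_bracketSet hV k W hW
    have hcont : Continuous fun t => ⟪IccExtend zero_le_one q t,
        VectorField.lieBracket ℝ (V j) W (IccExtend zero_le_one φ t)⟫_ℝ :=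
      (q.continuous.Icc_extend').inner
        (((hV j).lieBracket_vectorField (m := ∞) hWs (by simp)).continuous.comp
          φ.continuous.Icc_extend')
    have hae : ∀ᵐ s, s ∈ A j → s ∈ Ioo 0 δ → ⟪IccExtend zero_le_one q s,
        VectorField.lieBracket ℝ (V j) W (IccExtend zero_le_one φ s)⟫_ℝ = 0 := by
      filter_upwards [hv j, ae_hasDerivAt_of_eq_const_add_volterra hφ,
        ae_hasDerivAt_of_eq_const_add_volterra hq] with s hvs hφs hqs hsA hs
      have hs1 : s ∈ Ioo (0 : ℝ) 1 := ⟨hs.1, hs.2.trans_le hδ1⟩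
      have h1 : HasDerivAt (IccExtend zero_le_one φ)
          (fieldMap V (IccExtend zero_le_one φ s) (v s)) s := hφs hs1
      have h2 : HasDerivAt (IccExtend zero_le_one q) (adjointField V (IccExtend zero_le_one φ s)
          (IccExtend zero_le_one q s) (v s)) s := hqs hs1
      rw [hvs hsA hs] at h1 h2
      have h3 := hasDerivAt_inner_field hWs h2 h1
      -- By the induction hypothesis the differentiated function vanishes near `s`, so its
      -- derivative, which is the bracket term, is zero.
      refine h3.unique ((hasDerivAt_const s (0 : ℝ)).congr_of_eventuallyEq ?_)
      filter_upwards [Ioo_mem_nhds hs.1 hs.2] with t ht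
      exact ih W hW t (Ioo_subset_Icc_self ht)
    exact eqOn_zero_of_ae_eq_zero_on (hA j) hcont hδ hae

/-- Along a control that starts as a step control with everywhere-dense level sets, no nonzero
vector is orthogonal to the range of the derivative of the end point. -/
theorem eq_zero_of_forall_inner_fderiv_solutionMap_eq_zero (hV : SmoothBoundedDerivatives V)
    (hH : StrongHormander V) {K : NNReal} (hK : LipschitzWith K (fieldMap V))
    (x : EuclideanSpace ℝ (Fin n)) (v : VelocitySpace d)
    {A : Fin d → Set ℝ} (hA : ∀ (j : Fin d) (a b : ℝ), a < b → 0 < volume (A j ∩ Ioo a b))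
    {δ : ℝ} (hδ : 0 < δ) (hδ1 : δ ≤ 1)
    (hv : ∀ j, ∀ᵐ s, s ∈ A j → s ∈ Ioo 0 δ → v s = EuclideanSpace.single j 1)
    {p : EuclideanSpace ℝ (Fin n)}
    (hp : ∀ w, ⟪p, fderiv ℝ (solutionMap hV.contDiff_fieldMap.continuous hK x) v w 1⟫_ℝ = 0) :
    p = 0 := by
  have hV1 : ∀ i, ContDiff ℝ 1 (V i) := fun i => (hV i).1.of_le (by exact_mod_cast le_top)
  have hσ := hV.contDiff_fieldMap
  set φ := solutionMap hσ.continuous hK x v with hφdef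
  obtain ⟨Q, hQ⟩ := exists_linearMap_adjoint_solution hV hV1 φ v
  -- The adjoint path is parametrised by its initial value `p₀`, since Hörmander's condition is used
  -- at time `0`, where `φ` equals `x`.
  have key : ∀ p₀, (∀ w, ⟪Q p₀ 1,
      fderiv ℝ (solutionMap hσ.continuous hK x) v w 1⟫_ℝ = 0) → p₀ = 0 := by
    intro p₀ hp₀
    have h1 : ∀ w : VelocitySpace d, ∫ s in (0 : ℝ)..1, ⟪IccExtend zero_le_one (Q p₀) s,
        fieldMap V (IccExtend zero_le_one φ s) (w s)⟫_ℝ = 0 := fun w => by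
      rw [← inner_adjoint_eq_integral hV1 hσ (hQ p₀) (fderiv_solutionMap_apply hσ hK x v w)]
      exact hp₀ w
    have h2 := inner_field_eq_zero_of_forall_integral_eq_zero (fun i => (hV1 i).continuous) h1
    have h3 := inner_bracket_eq_zero (fun i => (hV i).1) hV1 hσ.continuous
      (solutionMap_eq hσ.continuous hK x v) (hQ p₀) hA hδ hδ1 hv
      (fun i t ht => h2 i t ⟨ht.1, ht.2.trans hδ1⟩)
    have h4 : ∀ k, ∀ W ∈ bracketSet V k, ⟪p₀, W x⟫_ℝ = 0 := by
      intro k W hW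
      have h5 := h3 k W hW 0 (left_mem_Icc.mpr hδ.le)
      have hq0 : Q p₀ 0 = p₀ := by
        have := congrArg (fun ψ : PathSpace _ => ψ 0) (hQ p₀)
        simpa [volterra_apply] using this
      have hφ0 : φ 0 = x := by
        have := congrArg (fun ψ : PathSpace _ => ψ 0) (solutionMap_eq hσ.continuous hK x v)
        simpa [volterra_apply] using this
      rw [IccExtend_left, IccExtend_left] at h5
      rwa [← hq0, ← hφ0]
    have h6 : Submodule.span ℝ (⋃ k, (fun W => W x) '' bracketSet V k) ≤
        (ℝ ∙ p₀)ᗮ := by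
      rw [Submodule.span_le]
      refine iUnion_subset fun k => ?_
      rintro _ ⟨W, hW, rfl⟩
      exact Submodule.mem_orthogonal_singleton_iff_inner_right.mpr (h4 k W hW)
    rw [hH x] at h6
    exact inner_self_eq_zero.mp
      (Submodule.mem_orthogonal_singleton_iff_inner_right.mp (h6 (Submodule.mem_top (x := p₀))))
  -- To reach a prescribed terminal value `p`, the map from initial to terminal value must be onto.
  -- Its injectivity already follows from `key`, and the dimension is finite.
  let T : EuclideanSpace ℝ (Fin n) →ₗ[ℝ] EuclideanSpace ℝ (Fin n) :=
    (PathSpace.evalCLM 1).toLinearMap ∘ₗ Q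
  have hinj : Function.Injective T := by
    rw [← LinearMap.ker_eq_bot, LinearMap.ker_eq_bot']
    intro p₀ hp₀
    refine key p₀ fun w => ?_
    change ⟪T p₀, _⟫_ℝ = 0
    rw [hp₀, inner_zero_left]
  obtain ⟨p₀, rfl⟩ := LinearMap.injective_iff_surjective.mp hinj p
  rw [key p₀ hp, map_zero]

end Bracket

/-! ### Continuity of dilations in `L²` -/

section Dilation

variable {E : Type*} [NormedAddCommGroup E] [NormedSpace ℝ E]

/-- The function `f` sped up and delayed so that the interval `[c, 1]` is mapped onto `[0, 1]`,
with the velocity rescaled accordingly. -/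
noncomputable def delayed (c : ℝ) (f : ℝ → E) (t : ℝ) : E := (1 - c)⁻¹ • f ((1 - c)⁻¹ * (t - c))

/-- The image of Lebesgue measure under a map of slope `a` is `a⁻¹` times Lebesgue measure. -/
theorem map_volume_mul_sub_le {a : ℝ} (ha : 1 ≤ a) (c : ℝ) :
    (volume : Measure ℝ).map (fun t => a * (t - c)) ≤ volume := by
  have h0 : a ≠ 0 := (zero_lt_one.trans_le ha).ne'
  have h1 : (fun t : ℝ => a * (t - c)) = (fun t => a * t) ∘ fun t => t - c := rfl
  rw [h1, ← Measure.map_map (measurable_const_mul a) (measurable_sub_const c),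
    map_sub_right_eq_self, Real.map_volume_mul_left h0]
  refine Measure.le_iff.mpr fun s _ => ?_
  rw [Measure.smul_apply, smul_eq_mul]
  refine mul_le_of_le_one_left' ?_
  rw [ENNReal.ofReal_le_one, abs_of_nonneg (inv_nonneg.mpr (zero_le_one.trans ha))]
  exact inv_le_one_of_one_le₀ ha

theorem one_le_inv_one_sub {c : ℝ} (h0 : 0 ≤ c) (h1 : c ≤ 1 / 2) : 1 ≤ (1 - c)⁻¹ :=
  (one_le_inv₀ (by linarith)).mpr (by linarith)

theorem memLp_delayed {f : ℝ → E} (hf : MemLp f 2 volume) {c : ℝ} (h0 : 0 ≤ c) (h1 : c ≤ 1 / 2) :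
    MemLp (delayed c f) 2 volume := by
  have hle := map_volume_mul_sub_le (one_le_inv_one_sub h0 h1) c
  exact ((hf.mono_measure hle).comp_of_map (by fun_prop)).const_smul _

theorem eLpNorm_delayed_le {f : ℝ → E} (hf : MemLp f 2 volume) {c : ℝ} (h0 : 0 ≤ c)
    (h1 : c ≤ 1 / 2) : eLpNorm (delayed c f) 2 volume ≤ 2 * eLpNorm f 2 volume := by
  have hle := map_volume_mul_sub_le (one_le_inv_one_sub h0 h1) c
  have h2 : eLpNorm (fun t => f ((1 - c)⁻¹ * (t - c))) 2 volume ≤ eLpNorm f 2 volume := by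
    have h3 := eLpNorm_map_measure (hf.mono_measure hle).aestronglyMeasurable
      (f := fun t => (1 - c)⁻¹ * (t - c)) (p := 2) (by fun_prop)
    exact h3.symm.le.trans (eLpNorm_mono_measure f hle)
  refine (eLpNorm_const_smul_le (c := (1 - c)⁻¹)).trans (mul_le_mul' ?_ h2)
  have h4 : (1 - c)⁻¹ ≤ 2 := by
    rw [inv_le_comm₀ (by linarith) (by norm_num)]
    linarith
  rw [← ofReal_norm, Real.norm_of_nonneg (inv_nonneg.mpr (by linarith))]
  exact (ENNReal.ofReal_le_ofReal h4).trans (by simp)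

theorem eventually_norm_delayed_sub_le {g : ℝ → E} (hg : Continuous g) {r : ℝ} (hr : 0 < r) :
    ∀ᶠ c in nhds (0 : ℝ), ∀ t ∈ Icc (0 : ℝ) 1, ‖delayed c g t - g t‖ < r := by
  refine isCompact_Icc.eventually_forall_of_forall_eventually fun t _ => ?_
  have hinv : ContinuousAt (fun p : ℝ × ℝ => (1 - p.1)⁻¹) (0, t) :=
    ContinuousAt.inv₀ (by fun_prop) (by simp)
  have hc : ContinuousAt (fun p : ℝ × ℝ => ‖delayed p.1 g p.2 - g p.2‖) (0, t) := by
    refine ((hinv.smul (hg.continuousAt.comp (hinv.mul (by fun_prop)))).sub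
      (hg.continuousAt.comp continuousAt_snd)).norm
  have h0 : ‖delayed ((0 : ℝ), t).1 g ((0 : ℝ), t).2 - g ((0 : ℝ), t).2‖ < r := by
    simpa [delayed] using hr
  exact hc.eventually_lt continuousAt_const h0

/-- Delayed functions converge in `L²([0,1])` as the delay tends to zero. -/
theorem eventually_eLpNorm_delayed_sub_lt {f : ℝ → E} (hf : MemLp f 2 volume) {r : ENNReal}
    (hr : 0 < r) : ∀ᶠ c in nhdsWithin (0 : ℝ) (Ici 0),
      eLpNorm (delayed c f - f) 2 (volume.restrict (Icc 0 1)) < r := by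
  -- With `g` continuous, compactly supported and within `η` of `f`, the errors are `2η` (a delay at
  -- most doubles the norm), `η` for `g` itself, and `η` again, hence `4η`.
  obtain ⟨η, hη, hηr⟩ : ∃ η : ENNReal, 0 < η ∧ 4 * η < r := by
    obtain ⟨η, hη, hηr⟩ := exists_between (ENNReal.div_pos hr.ne' (by norm_num : (4 : ENNReal) ≠ ⊤))
    exact ⟨η, hη, by rw [mul_comm]; exact (ENNReal.lt_div_iff_mul_lt (by simp) (by simp)).mp hηr⟩
  have hη' : ∃ ρ : ℝ, 0 < ρ ∧ ENNReal.ofReal ρ ≤ η := by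
    obtain ⟨ρ, h0, h1⟩ := ENNReal.lt_iff_exists_nnreal_btwn.mp hη
    exact ⟨ρ, by simpa using h0, by simpa using h1.le⟩
  obtain ⟨ρ, hρ, hρη⟩ := hη'
  obtain ⟨g, -, hgf, hgc, hg⟩ := hf.exists_hasCompactSupport_eLpNorm_sub_le (by norm_num) hη.ne'
  filter_upwards [nhdsWithin_le_nhds (eventually_norm_delayed_sub_le hgc hρ), self_mem_nhdsWithin,
    nhdsWithin_le_nhds (Iic_mem_nhds (by norm_num : (0 : ℝ) < 1 / 2))] with c hc h0 h1
  have hfg := hf.sub hg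
  have hsplit : delayed c f - f = (delayed c (f - g) + (delayed c g - g)) - (f - g) := by
    funext t
    simp only [delayed, Pi.sub_apply, Pi.add_apply, smul_sub]
    abel
  have hm1 := (memLp_delayed hfg h0 h1).restrict (Icc 0 1)
  have hm2 := ((memLp_delayed hg h0 h1).sub hg).restrict (Icc 0 1)
  have e1 : eLpNorm (delayed c (f - g)) 2 (volume.restrict (Icc 0 1)) ≤ 2 * η :=
    (eLpNorm_restrict_le _ _ _ _).trans ((eLpNorm_delayed_le hfg h0 h1).trans (by gcongr))
  have e2 : eLpNorm (delayed c g - g) 2 (volume.restrict (Icc (0 : ℝ) 1)) ≤ η := by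
    refine (eLpNorm_le_of_ae_bound (C := ρ) ?_).trans ?_
    · filter_upwards [ae_restrict_mem measurableSet_Icc] with t ht using (hc t ht).le
    · simpa using hρη
  have e3 : eLpNorm (f - g) 2 (volume.restrict (Icc (0 : ℝ) 1)) ≤ η :=
    (eLpNorm_restrict_le _ _ _ _).trans hgf
  rw [hsplit]
  calc _ ≤ (eLpNorm (delayed c (f - g)) 2 (volume.restrict (Icc 0 1)) +
        eLpNorm (delayed c g - g) 2 (volume.restrict (Icc 0 1))) +
        eLpNorm (f - g) 2 (volume.restrict (Icc 0 1)) :=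
        (eLpNorm_sub_le (hm1.add hm2).1 (hfg.restrict _).1 (by norm_num)).trans
          (add_le_add_left (eLpNorm_add_le hm1.1 hm2.1 (by norm_num)) _)
    _ ≤ (2 * η + η) + η := add_le_add (add_le_add e1 e2) e3
    _ = 4 * η := by ring
    _ < r := hηr

end Dilation

/-! ### Short loops are small in `L²` -/

section LoopControl

variable {E : Type*} [NormedAddCommGroup E]

/-- The control `u` run on `[0, δ]`, then backwards on `[δ, 2δ]`. -/
noncomputable def loopControl (δ : ℝ) (u : ℝ → E) (t : ℝ) : E :=
  if t ≤ δ then u t else if t ≤ 2 * δ then -u (2 * δ - t) else 0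

theorem norm_loopControl_le {δ M : ℝ} {u : ℝ → E} (hM : ∀ t, ‖u t‖ ≤ M) (t : ℝ) :
    ‖loopControl δ u t‖ ≤ M := by
  unfold loopControl
  split_ifs
  · exact hM t
  · rw [norm_neg]
    exact hM _
  · rw [norm_zero]
    exact (norm_nonneg _).trans (hM t)

theorem stronglyMeasurable_loopControl (δ : ℝ) {u : ℝ → E} (hu : StronglyMeasurable u) :
    StronglyMeasurable (loopControl δ u) :=
  hu.ite measurableSet_Iic
    (((hu.comp_measurable (by fun_prop : Measurable fun t : ℝ => 2 * δ - t)).neg).ite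
      measurableSet_Iic stronglyMeasurable_const)

theorem memLp_loopControl {δ M : ℝ} {u : ℝ → E} (hu : StronglyMeasurable u)
    (hM : ∀ t, ‖u t‖ ≤ M) : MemLp (loopControl δ u) 2 (volume.restrict (Icc (0 : ℝ) 1)) :=
  MemLp.of_bound (stronglyMeasurable_loopControl δ hu).aestronglyMeasurable M
    (Filter.Eventually.of_forall (norm_loopControl_le hM))

theorem eLpNorm_loopControl_le {δ M : ℝ} (hδ : 0 ≤ δ) {u : ℝ → E} (hM : ∀ t, ‖u t‖ ≤ M) :
    eLpNorm (loopControl δ u) 2 (volume.restrict (Icc (0 : ℝ) 1)) ≤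
      ENNReal.ofReal (2 * δ) ^ (2⁻¹ : ℝ) * ENNReal.ofReal M := by
  have h1 : loopControl δ u = (Iic (2 * δ)).indicator (loopControl δ u) := by
    refine (indicator_eq_self.mpr fun t ht => ?_).symm
    by_contra hcon
    rw [mem_Iic, not_le] at hcon
    exact ht (by rw [loopControl, if_neg (by linarith), if_neg hcon.not_ge])
  rw [h1, eLpNorm_indicator_eq_eLpNorm_restrict measurableSet_Iic]
  refine (eLpNorm_le_of_ae_bound
    (Filter.Eventually.of_forall (norm_loopControl_le hM))).trans (mul_le_mul' ?_ le_rfl)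
  rw [Measure.restrict_apply_univ, Measure.restrict_apply measurableSet_Iic]
  have h2 : volume (Iic (2 * δ) ∩ Icc (0 : ℝ) 1) ≤ ENNReal.ofReal (2 * δ) := by
    refine (measure_mono (t := Icc 0 (2 * δ)) fun t ht => ⟨ht.2.1, ht.1⟩).trans ?_
    rw [Real.volume_Icc, sub_zero]
  simpa using ENNReal.rpow_le_rpow h2 (by norm_num : (0 : ℝ) ≤ 2⁻¹)

theorem eventually_eLpNorm_loopControl_lt {M : ℝ} {u : ℝ → E} (hM : ∀ t, ‖u t‖ ≤ M)
    {r : ENNReal} (hr : 0 < r) : ∀ᶠ δ in nhdsWithin (0 : ℝ) (Ici 0),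
      eLpNorm (loopControl δ u) 2 (volume.restrict (Icc (0 : ℝ) 1)) < r := by
  have hc : Continuous fun δ : ℝ => ENNReal.ofReal (2 * δ) ^ (2⁻¹ : ℝ) * ENNReal.ofReal M :=
    (ENNReal.continuous_mul_const ENNReal.ofReal_ne_top).comp
      ((ENNReal.continuous_rpow_const).comp (ENNReal.continuous_ofReal.comp (by fun_prop)))
  have h0 : ENNReal.ofReal (2 * 0) ^ (2⁻¹ : ℝ) * ENNReal.ofReal M < r := by simpa using hr
  filter_upwards [nhdsWithin_le_nhds (hc.continuousAt.eventually_lt continuousAt_const h0),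
    self_mem_nhdsWithin] with δ h1 h2
  exact (eLpNorm_loopControl_le h2 hM).trans_lt h1

end LoopControl

/-! ### The path driven by a loop followed by a delayed control -/

section LoopPath

variable {F : Type*} [NormedAddCommGroup F]

/-- The path that follows `ψ` on `[0, δ]`, comes back on `[δ, 2δ]`, and then follows `φ` sped up. -/
noncomputable def loopPath (δ : ℝ) (ψ φ : ℝ → F) (t : ℝ) : F :=
  if t ≤ δ then ψ t else if t ≤ 2 * δ then ψ (2 * δ - t) else φ ((1 - 2 * δ)⁻¹ * (t - 2 * δ))

theorem continuous_loopPath (δ : ℝ) (hδ : 0 ≤ δ) {ψ φ : ℝ → F} (hψ : Continuous ψ)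
    (hφ : Continuous φ) (h0 : ψ 0 = φ 0) : Continuous (loopPath δ ψ φ) := by
  refine hψ.if_le (Continuous.if_le (hψ.comp (by fun_prop)) (hφ.comp (by fun_prop)) continuous_id
    continuous_const ?_) continuous_id continuous_const ?_
  · rintro t rfl
    simpa using h0
  · rintro t rfl
    rw [if_pos (by linarith)]
    congr 1
    ring

variable {E : Type*} [NormedAddCommGroup E] [NormedSpace ℝ E] [NormedSpace ℝ F]

/-- Invariance of the controlled equation under affine time changes. Slope `-1` retraces a path, and
slope `(1 - 2δ)⁻¹` speeds it up. -/
theorem sub_eq_integral_affine {σ : F → E →L[ℝ] F} {φ : ℝ → F} {v : ℝ → E}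
    (hφ : ∀ s ∈ Icc (0 : ℝ) 1, ∀ t ∈ Icc (0 : ℝ) 1, φ t - φ s = ∫ r in s..t, σ (φ r) (v r))
    (c e : ℝ) {a b : ℝ} (ha : c * a + e ∈ Icc (0 : ℝ) 1) (hb : c * b + e ∈ Icc (0 : ℝ) 1) :
    φ (c * b + e) - φ (c * a + e) = ∫ r in a..b, σ (φ (c * r + e)) (c • v (c * r + e)) := by
  rw [hφ _ ha _ hb, ← intervalIntegral.smul_integral_comp_mul_add
    (fun r => σ (φ r) (v r)) c e, ← intervalIntegral.integral_smul]
  simp only [map_smul]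

/-- The loop path solves the equation driven by the loop control followed by the delayed control. -/
theorem loopPath_eq_add_integral {σ : F → E →L[ℝ] F} {ψ φ : ℝ → F} {u f : ℝ → E}
    (hψ : ∀ s ∈ Icc (0 : ℝ) 1, ∀ t ∈ Icc (0 : ℝ) 1, ψ t - ψ s = ∫ r in s..t, σ (ψ r) (u r))
    (hφ : ∀ s ∈ Icc (0 : ℝ) 1, ∀ t ∈ Icc (0 : ℝ) 1, φ t - φ s = ∫ r in s..t, σ (φ r) (f r))
    (hf : ∀ r ≤ 0, f r = 0) (h0 : ψ 0 = φ 0) {δ : ℝ} (hδ : 0 < δ) (hδ1 : 2 * δ ≤ 1 / 2)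
    (hint : ∀ a ∈ Icc (0 : ℝ) 1, ∀ b ∈ Icc (0 : ℝ) 1, IntervalIntegrable
      (fun r => σ (loopPath δ ψ φ r) (loopControl δ u r + delayed (2 * δ) f r)) volume a b)
    {t : ℝ} (ht : t ∈ Icc (0 : ℝ) 1) :
    loopPath δ ψ φ t = φ 0 + ∫ r in (0 : ℝ)..t,
      σ (loopPath δ ψ φ r) (loopControl δ u r + delayed (2 * δ) f r) := by
  set G : ℝ → F := fun r => σ (loopPath δ ψ φ r) (loopControl δ u r + delayed (2 * δ) f r) with hG
  have hpos : 0 < (1 - 2 * δ)⁻¹ := inv_pos.mpr (by linarith)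
  -- Since `f` vanishes on `(-∞, 0]`, the delayed control is silent during the loop.
  have hdel : ∀ r ≤ 2 * δ, delayed (2 * δ) f r = 0 := fun r hr => by
    rw [delayed, hf _ (mul_nonpos_of_nonneg_of_nonpos hpos.le (by linarith)), smul_zero]
  have hI1 : ∀ t ∈ Icc (0 : ℝ) δ, ∫ r in (0 : ℝ)..t, G r = ψ t - ψ 0 := by
    intro t ht
    rw [hψ 0 ⟨le_rfl, zero_le_one⟩ t ⟨ht.1, by linarith [ht.2]⟩]
    refine intervalIntegral.integral_congr_ae (Filter.Eventually.of_forall fun r hr => ?_)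
    rw [uIoc_of_le ht.1] at hr
    have h1 : r ≤ δ := hr.2.trans ht.2
    simp only [hG, loopPath, loopControl, if_pos h1, hdel r (by linarith), add_zero]
  have hI2 : ∀ t ∈ Icc δ (2 * δ), ∫ r in δ..t, G r = ψ (2 * δ - t) - ψ δ := by
    intro t ht
    have h1 := sub_eq_integral_affine hψ (-1) (2 * δ) (a := δ) (b := t)
      ⟨by linarith, by linarith⟩ ⟨by linarith [ht.2], by linarith [ht.1]⟩
    rw [show -1 * t + 2 * δ = 2 * δ - t by ring, show -1 * δ + 2 * δ = δ by ring] at h1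
    rw [h1]
    refine intervalIntegral.integral_congr_ae (Filter.Eventually.of_forall fun r hr => ?_)
    rw [uIoc_of_le ht.1] at hr
    have h2 : r ≤ 2 * δ := hr.2.trans ht.2
    have h3 : -1 * r + 2 * δ = 2 * δ - r := by ring
    simp only [hG, loopPath, loopControl, if_neg hr.1.not_ge, if_pos h2, hdel r h2, add_zero, h3,
      neg_smul, one_smul]
  have hI3 : ∀ t ∈ Icc (2 * δ) 1,
      ∫ r in (2 * δ)..t, G r = φ ((1 - 2 * δ)⁻¹ * (t - 2 * δ)) - φ 0 := by
    intro t ht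
    have h1 := sub_eq_integral_affine hφ (1 - 2 * δ)⁻¹ (-((1 - 2 * δ)⁻¹ * (2 * δ)))
      (a := 2 * δ) (b := t) (by simp) (by
        rw [← sub_eq_add_neg, ← mul_sub]
        refine ⟨mul_nonneg hpos.le (by linarith [ht.1]), ?_⟩
        rw [inv_mul_le_iff₀ (by linarith)]
        linarith [ht.2])
    simp only [← sub_eq_add_neg, ← mul_sub, sub_self] at h1
    rw [h1]
    refine intervalIntegral.integral_congr_ae (Filter.Eventually.of_forall fun r hr => ?_)
    rw [uIoc_of_le ht.1] at hr
    simp only [hG, loopPath, loopControl, if_neg hr.1.not_ge,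
      if_neg (show ¬ r ≤ δ by linarith [hr.1]), zero_add, delayed]
  have hδm : δ ∈ Icc (0 : ℝ) 1 := ⟨hδ.le, by linarith⟩
  have h2δm : 2 * δ ∈ Icc (0 : ℝ) 1 := ⟨by linarith, by linarith⟩
  have h0m : (0 : ℝ) ∈ Icc (0 : ℝ) 1 := ⟨le_rfl, zero_le_one⟩
  rcases le_or_gt t δ with h1 | h1
  · rw [hI1 t ⟨ht.1, h1⟩, loopPath, if_pos h1, h0]
    abel
  · rw [← intervalIntegral.integral_add_adjacent_intervals (hint 0 h0m δ hδm) (hint δ hδm t ht),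
      hI1 δ ⟨hδ.le, le_rfl⟩]
    rcases le_or_gt t (2 * δ) with h2 | h2
    · rw [hI2 t ⟨h1.le, h2⟩, loopPath, if_neg h1.not_ge, if_pos h2, h0]
      abel
    · rw [← intervalIntegral.integral_add_adjacent_intervals (hint δ hδm _ h2δm)
        (hint _ h2δm t ht), hI2 _ ⟨by linarith, le_rfl⟩, hI3 t ⟨h2.le, ht.2⟩, loopPath,
        if_neg h1.not_ge, if_neg h2.not_ge, sub_self, h0]
      abel

end LoopPath

/-! ### A loop leaves the end point unchanged -/

section Loop

variable {d : ℕ} {F : Type*} [NormedAddCommGroup F] [NormedSpace ℝ F] [CompleteSpace F]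
  {σ : F → EuclideanSpace ℝ (Fin d) →L[ℝ] F} {K : NNReal}

theorem solutionMap_sub_eq_integral (hσ : Continuous σ) (hK : LipschitzWith K σ) (x : F)
    {v : VelocitySpace d} {f : ℝ → EuclideanSpace ℝ (Fin d)}
    (hf : v =ᵐ[volume.restrict (Icc (0 : ℝ) 1)] f) :
    ∀ s ∈ Icc (0 : ℝ) 1, ∀ t ∈ Icc (0 : ℝ) 1,
      IccExtend zero_le_one (solutionMap hσ hK x v) t -
        IccExtend zero_le_one (solutionMap hσ hK x v) s =
      ∫ r in s..t, σ (IccExtend zero_le_one (solutionMap hσ hK x v) r) (f r) := by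
  have h0 : ∀ t ∈ Icc (0 : ℝ) 1, IccExtend zero_le_one (solutionMap hσ hK x v) t =
      x + ∫ r in (0 : ℝ)..t, σ (IccExtend zero_le_one (solutionMap hσ hK x v) r) (v r) := by
    intro t ht
    rw [IccExtend_of_mem _ _ ht]
    conv_lhs => rw [solutionMap_eq hσ hK x v]
    rfl
  have hi : ∀ t ∈ Icc (0 : ℝ) 1, IntervalIntegrable
      (fun r => σ (IccExtend zero_le_one (solutionMap hσ hK x v) r) (v r)) volume 0 t :=
    fun t ht => intervalIntegrable_extend_apply (superpose hσ (solutionMap hσ hK x v)) v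
      (left_mem_Icc.mpr zero_le_one) ht
  intro s hs t ht
  rw [h0 s hs, h0 t ht, add_sub_add_left_eq_sub,
    intervalIntegral.integral_interval_sub_left (hi t ht) (hi s hs)]
  rw [Filter.EventuallyEq, ae_restrict_iff' measurableSet_Icc] at hf
  refine intervalIntegral.integral_congr_ae ?_
  filter_upwards [hf] with r hr hrst
  rw [hr (ordConnected_Icc.uIcc_subset hs ht (uIoc_subset_uIcc hrst))]

/-- Inserting a loop at the start does not change the end point. -/
theorem solutionMap_loop_one (hσ : Continuous σ) (hK : LipschitzWith K σ) (x : F)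
    {v u' w : VelocitySpace d} {u f : ℝ → EuclideanSpace ℝ (Fin d)}
    (hu : u' =ᵐ[volume.restrict (Icc (0 : ℝ) 1)] u) (hv : v =ᵐ[volume.restrict (Icc (0 : ℝ) 1)] f)
    (hf : ∀ r ≤ 0, f r = 0) {δ : ℝ} (hδ : 0 < δ) (hδ1 : 2 * δ ≤ 1 / 2)
    (hw : w =ᵐ[volume.restrict (Icc (0 : ℝ) 1)] loopControl δ u + delayed (2 * δ) f) :
    solutionMap hσ hK x w 1 = solutionMap hσ hK x v 1 := by
  have hinit : ∀ v : VelocitySpace d, solutionMap hσ hK x v 0 = x := fun v => by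
    have := congrArg (fun ψ : PathSpace _ => ψ 0) (solutionMap_eq hσ hK x v)
    simpa [volterra_apply] using this
  set ψ := IccExtend zero_le_one (solutionMap hσ hK x u') with hψ
  set φ := IccExtend zero_le_one (solutionMap hσ hK x v) with hφ
  have hφ0 : φ 0 = x := by rw [hφ, IccExtend_left]; exact hinit v
  have hψ0 : ψ 0 = φ 0 := by rw [hφ0, hψ, IccExtend_left]; exact hinit u'
  have hcont : Continuous (loopPath δ ψ φ) := continuous_loopPath δ hδ.le
    ((solutionMap hσ hK x u').continuous.Icc_extend')
    ((solutionMap hσ hK x v).continuous.Icc_extend')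
    hψ0
  -- The explicit loop path is shown to solve the equation driven by `w`; uniqueness then gives its
  -- end point.
  let χ : PathSpace F := .mk (fun t => loopPath δ ψ φ t) (hcont.comp continuous_subtype_val)
  have hχw : ∀ᵐ r, r ∈ Icc (0 : ℝ) 1 → IccExtend zero_le_one (superpose hσ χ) r (w r) =
      σ (loopPath δ ψ φ r) (loopControl δ u r + delayed (2 * δ) f r) := by
    rw [Filter.EventuallyEq, ae_restrict_iff' measurableSet_Icc] at hw
    filter_upwards [hw] with r hr hr01
    rw [IccExtend_of_mem _ _ hr01, hr hr01]
    rfl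
  have hint : ∀ a ∈ Icc (0 : ℝ) 1, ∀ b ∈ Icc (0 : ℝ) 1, IntervalIntegrable
      (fun r => σ (loopPath δ ψ φ r) (loopControl δ u r + delayed (2 * δ) f r)) volume a b := by
    intro a ha b hb
    refine (intervalIntegrable_extend_apply (superpose hσ χ) w ha hb).congr_ae ?_
    rw [Filter.EventuallyEq, ae_restrict_iff' measurableSet_uIoc]
    filter_upwards [hχw] with r hr hrab
    exact hr (ordConnected_Icc.uIcc_subset ha hb (uIoc_subset_uIcc hrab))
  have hχ : χ = PathSpace.const x + volterra d F (superpose hσ χ) w := by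
    ext1 t
    refine (loopPath_eq_add_integral (solutionMap_sub_eq_integral hσ hK x hu)
      (solutionMap_sub_eq_integral hσ hK x hv) hf hψ0 hδ hδ1 hint t.2).trans ?_
    rw [PathSpace.add_apply, PathSpace.const_apply, volterra_apply, ← hφ, hφ0]
    congr 1
    refine intervalIntegral.integral_congr_ae ?_
    filter_upwards [hχw] with r hr hrt
    rw [uIoc_of_le t.2.1] at hrt
    exact (hr ⟨hrt.1.le, hrt.2.trans t.2.2⟩).symm
  rw [← eq_solutionMap hσ hK hχ]
  change loopPath δ ψ φ 1 = _
  rw [loopPath, if_neg (by linarith), if_neg (by linarith), inv_mul_cancel₀ (by linarith), hφ,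
    IccExtend_right]
  rfl

end Loop

/-! ### Level sets meet dense subspaces -/

section DenseCorrection

/-- Level sets of a map that is strictly differentiable with surjective derivative at `a` contain
points of a given dense subspace arbitrarily close to `a`. -/
theorem HasStrictFDerivAt.exists_mem_dense_submodule_eq {H F : Type*} [NormedAddCommGroup H]
    [NormedSpace ℝ H] [CompleteSpace H] [NormedAddCommGroup F] [NormedSpace ℝ F]
    [FiniteDimensional ℝ F] {f : H → F} {f' : H →L[ℝ] F} {a : H} (hf : HasStrictFDerivAt f f' a)
    (hsurj : Function.Surjective f') {S : Submodule ℝ H} (hS : Dense (S : Set H)) {U : Set H}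
    (hU : U ∈ nhds a) : ∃ w ∈ U, w ∈ S ∧ f w = f a := by
  -- The image of `S` is a dense subspace of a finite-dimensional space, hence everything. So `f'`
  -- has a linear right inverse `L` with values in `S`.
  have hmap : S.map (f' : H →ₗ[ℝ] F) = ⊤ := by
    have h1 : Dense ((S.map (f' : H →ₗ[ℝ] F) : Submodule ℝ F) : Set F) := by
      have h2 := hsurj.denseRange.dense_image f'.continuous hS
      simpa using h2
    have h3 := (S.map (f' : H →ₗ[ℝ] F)).closed_of_finiteDimensional.closure_eq
    rw [h1.closure_eq] at h3
    exact SetLike.coe_injective (by rw [← h3]; rfl)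
  have hlift : ∀ y : F, ∃ s ∈ S, f' s = y := fun y => by
    have : y ∈ S.map (f' : H →ₗ[ℝ] F) := hmap ▸ Submodule.mem_top
    simpa using this
  let b := Module.finBasis ℝ F
  choose g hgS hg using fun i => hlift (b i)
  let L₀ : F →ₗ[ℝ] H := b.constr ℝ g
  let L : F →L[ℝ] H := LinearMap.toContinuousLinearMap L₀
  have hLS : ∀ y, L y ∈ S := by
    intro y
    change L₀ y ∈ S
    rw [Module.Basis.constr_apply_fintype]
    exact S.sum_mem fun i _ => S.smul_mem _ (hgS i)
  have hL : ∀ y, f' (L y) = y := by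
    intro y
    change f' (L₀ y) = y
    rw [Module.Basis.constr_apply_fintype, map_sum]
    simp only [map_smul, hg]
    exact b.sum_equivFun y
  -- The correction is the first-order remainder of `f`, so `Θ` has derivative `id` at `a` and is
  -- locally open there.
  let Θ : H → H := fun w => w + L (f w - f a - f' (w - a))
  have hΘ : HasStrictFDerivAt Θ (ContinuousLinearEquiv.refl ℝ H : H →L[ℝ] H) a := by
    have h1 := (hasStrictFDerivAt_id (𝕜 := ℝ) a).add (L.hasStrictFDerivAt.comp a
      ((hf.sub_const (f a)).sub (f'.hasStrictFDerivAt.comp a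
        ((hasStrictFDerivAt_id (𝕜 := ℝ) a).sub_const a))))
    refine h1.congr_fderiv ?_
    ext w
    simp
  have hΘa : Θ a = a := by simp [Θ]
  have hnhds : Θ '' U ∈ nhds a := by
    rw [← hΘa, ← hΘ.map_nhds_eq_of_equiv]
    exact Filter.image_mem_map hU
  have hcont : Continuous fun s : H => s - L (f' (s - a)) := by fun_prop
  have h0 : (fun s : H => s - L (f' (s - a))) a = a := by simp
  have hpre := hcont.continuousAt.preimage_mem_nhds (h0.symm ▸ hnhds)
  -- Some `w ∈ U` satisfies `Θ w = s - L (f' (s - a))` with `s ∈ S`. Every term other than `w` lies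
  -- in `S`, so `w ∈ S`; applying `f'` and cancelling leaves `f w = f a`.
  obtain ⟨s, hs, hsS⟩ := hS.exists_mem_open isOpen_interior ⟨a, mem_interior_iff_mem_nhds.mpr hpre⟩
  obtain ⟨w, hwU, hw⟩ := interior_subset hsS
  have hw' : w + L (f w - f a - f' (w - a)) = s - L (f' (s - a)) := hw
  refine ⟨w, hwU, ?_, ?_⟩
  · rw [eq_sub_of_add_eq hw']
    exact S.sub_mem (S.sub_mem hs (hLS _)) (hLS _)
  · have h1 := congrArg f' hw'
    rw [map_add, hL, map_sub f' s, hL, map_sub, map_sub] at h1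
    have h2 : f w - f a = 0 := by
      have : f w - f a = (f' w + (f w - f a - (f' w - f' a))) - f' a := by abel
      rw [this, h1]
      abel
    exact sub_eq_zero.mp h2

end DenseCorrection

/-! ### Density of the functionals that extend to Wiener space -/

section Wiener

variable {d : ℕ}

/-- The subspace of the Cameron–Martin space of the paths that extend to Wiener space. -/
def extendsToWienerSubmodule (d : ℕ) : Submodule ℝ (CameronMartin d) where
  carrier := {h | ExtendsToWiener h}
  zero_mem' := ⟨0, fun k => by simp⟩
  add_mem' := by
    rintro h h' ⟨ℓ, hℓ⟩ ⟨ℓ', hℓ'⟩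
    exact ⟨ℓ + ℓ', fun k => by rw [add_apply, hℓ, hℓ', inner_add_left]⟩
  smul_mem' := by
    rintro c h ⟨ℓ, hℓ⟩
    exact ⟨c • ℓ, fun k => by rw [smul_apply, hℓ, real_inner_smul_left, smul_eq_mul]⟩

/-- The coordinates at a time, as continuous linear functionals on Wiener space. -/
noncomputable def WienerSpace.evalCoord (t : unitInterval) (i : Fin d) : WienerSpace d →L[ℝ] ℝ :=
  LinearMap.mkContinuous
    { toFun := fun w => (w : C(unitInterval, EuclideanSpace ℝ (Fin d))) t i
      map_add' := fun _ _ => rfl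
      map_smul' := fun _ _ => rfl } 1
    fun w => by
      rw [one_mul]
      exact (PiLp.norm_apply_le _ i).trans
        ((w : C(unitInterval, EuclideanSpace ℝ (Fin d))).norm_coe_le_norm t)

/-- The coordinates at a time, as continuous linear functionals on the Cameron–Martin space. -/
noncomputable def CameronMartin.evalCoord (t : unitInterval) (i : Fin d) :
    StrongDual ℝ (CameronMartin d) :=
  (EuclideanSpace.proj i).comp ((PathSpace.evalCLM t).comp
    ((volterra d (EuclideanSpace ℝ (Fin d))
      (PathSpace.const (ContinuousLinearMap.id ℝ (EuclideanSpace ℝ (Fin d))))).comp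
        (CameronMartin.velocityIsometry d).toContinuousLinearEquiv.toContinuousLinearMap))

theorem CameronMartin.evalCoord_apply (t : unitInterval) (i : Fin d) (k : CameronMartin d) :
    CameronMartin.evalCoord t i k = WienerSpace.evalCoord t i (CameronMartin.toWiener d k) := by
  change _ = (CameronMartin.toWiener d k : C(unitInterval, EuclideanSpace ℝ (Fin d))) t i
  rw [CameronMartin.toWiener_apply]
  rfl

/-- The Riesz representers of the coordinate evaluations extend to Wiener space, and a path
orthogonal to all of them vanishes at every time. -/
theorem dense_extendsToWienerSubmodule :
    Dense (extendsToWienerSubmodule d : Set (CameronMartin d)) := by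
  rw [Submodule.dense_iff_topologicalClosure_eq_top, Submodule.topologicalClosure_eq_top_iff,
    Submodule.eq_bot_iff]
  intro k hk
  have h0 : ∀ (t : unitInterval) (i : Fin d),
      (CameronMartin.toWiener d k : C(unitInterval, EuclideanSpace ℝ (Fin d))) t i = 0 := by
    intro t i
    set r := (InnerProductSpace.toDual ℝ (CameronMartin d)).symm (CameronMartin.evalCoord t i)
      with hr
    have hrk : ∀ m, ⟪r, m⟫_ℝ = WienerSpace.evalCoord t i (CameronMartin.toWiener d m) := fun m => by
      rw [hr, InnerProductSpace.toDual_symm_apply, CameronMartin.evalCoord_apply]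
    have hmem : r ∈ extendsToWienerSubmodule d :=
      ⟨WienerSpace.evalCoord t i, fun m => (hrk m).symm⟩
    exact (hrk k).symm.trans ((Submodule.mem_orthogonal _ _).mp hk r hmem)
  refine Subtype.ext (ContinuousMap.ext fun t => ?_)
  ext i
  exact h0 t i

end Wiener

/-! ### Nondegenerate approximation and conclusion -/

section Covariance

variable {n d : ℕ} {V : Fin d → EuclideanSpace ℝ (Fin n) → EuclideanSpace ℝ (Fin n)}

/-- The covariance is the Gram matrix of the component derivatives; a linear relation among them is
a vector orthogonal to the range of `Dφ₁`. -/
theorem det_malliavinCovariance_ne_zero_of_forall {x : EuclideanSpace ℝ (Fin n)}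
    {h : CameronMartin d} (hinj : ∀ p : EuclideanSpace ℝ (Fin n),
      (∀ k, ⟪p, fderiv ℝ (fun k => skeletonFlow V 1 x k) h k⟫_ℝ = 0) → p = 0) :
    (malliavinCovariance V x h).det ≠ 0 := by
  have hgram : malliavinCovariance V x h = Matrix.gram ℝ fun i =>
      (InnerProductSpace.toDual ℝ (CameronMartin d)).symm (skeletonDeriv V x h i) := rfl
  rw [hgram, Matrix.det_gram_ne_zero_iff_linearIndependent, Fintype.linearIndependent_iff]
  intro c hc
  have hp : WithLp.toLp 2 c = (0 : EuclideanSpace ℝ (Fin n)) := by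
    refine hinj _ fun k => ?_
    have h1 := congrArg (fun m => ⟪m, k⟫_ℝ) hc
    simp only [sum_inner, real_inner_smul_left, InnerProductSpace.toDual_symm_apply,
      inner_zero_left] at h1
    rw [PiLp.inner_apply, ← h1]
    refine Finset.sum_congr rfl fun i _ => ?_
    simp [skeletonDeriv, mul_comm]
  intro i
  exact congrArg (fun p : EuclideanSpace ℝ (Fin n) => p i) hp

theorem continuous_det_malliavinCovariance (hV : SmoothBoundedDerivatives V)
    (x : EuclideanSpace ℝ (Fin n)) :
    Continuous fun h : CameronMartin d => (malliavinCovariance V x h).det := by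
  have h1 : Continuous (fderiv ℝ fun k : CameronMartin d => skeletonFlow V 1 x k) :=
    (contDiff_skeletonFlow_one hV x).continuous_fderiv one_ne_zero
  have h2 : ∀ i, Continuous fun h : CameronMartin d => skeletonDeriv V x h i := fun i =>
    continuous_const.clm_comp h1
  refine Continuous.matrix_det (continuous_matrix fun i j => ?_)
  have h3 : ∀ i, Continuous fun h : CameronMartin d =>
      (InnerProductSpace.toDual ℝ (CameronMartin d)).symm (skeletonDeriv V x h i) := fun i =>
    (InnerProductSpace.toDual ℝ (CameronMartin d)).symm.continuous.comp (h2 i)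
  exact (h3 i).inner (h3 j)

theorem surjective_of_forall_inner_eq_zero {H : Type*} [NormedAddCommGroup H] [NormedSpace ℝ H]
    {T : H →L[ℝ] EuclideanSpace ℝ (Fin n)} (hT : ∀ p, (∀ k, ⟪p, T k⟫_ℝ = 0) → p = 0) :
    Function.Surjective T := by
  have h1 : (LinearMap.range (T : H →ₗ[ℝ] EuclideanSpace ℝ (Fin n)))ᗮ = ⊥ := by
    rw [Submodule.eq_bot_iff]
    intro p hp
    refine hT p fun k => ?_
    rw [real_inner_comm]
    exact (Submodule.mem_orthogonal _ _).mp hp _ (LinearMap.mem_range_self _ k)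
  exact LinearMap.range_eq_top.mp (Submodule.orthogonal_eq_bot_iff.mp h1)

/-- Every control is approximated, with the same end points, by controls at which the derivative
of the end point is nondegenerate. -/
theorem exists_nondegenerate_near (hV : SmoothBoundedDerivatives V) (hH : StrongHormander V)
    {x x' : EuclideanSpace ℝ (Fin n)} {h : CameronMartin d} (hh : h ∈ pathsBetween V x x')
    {ε : ℝ} (hε : 0 < ε) : ∃ k ∈ pathsBetween V x x', ‖h - k‖ < ε ∧
      ∀ p : EuclideanSpace ℝ (Fin n),
        (∀ m, ⟪p, fderiv ℝ (fun k => skeletonFlow V 1 x k) k m⟫_ℝ = 0) → p = 0 := by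
  obtain ⟨K, hK⟩ := hV.exists_lipschitzWith_fieldMap
  have hσ := hV.contDiff_fieldMap.continuous
  obtain ⟨A, hAm, hAd, hA⟩ := exists_pairwise_disjoint_volume_pos d
  set u : ℝ → EuclideanSpace ℝ (Fin d) := stepControl A with hu
  have hum : StronglyMeasurable u := (measurable_stepControl hAm).stronglyMeasurable
  have hub : ∀ t, ‖u t‖ ≤ d := norm_stepControl_le
  have huL : MemLp u 2 (volume.restrict (Icc (0 : ℝ) 1)) :=
    MemLp.of_bound hum.aestronglyMeasurable d (Filter.Eventually.of_forall hub)
  set v : VelocitySpace d := CameronMartin.velocity d h with hv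
  -- The half-open interval makes `f` vanish at `0` too, as the gluing of loop and delayed control
  -- requires.
  set f : ℝ → EuclideanSpace ℝ (Fin d) := (Ioc (0 : ℝ) 1).indicator v with hf
  have hfL : MemLp f 2 volume := (memLp_indicator_iff_restrict measurableSet_Ioc).mpr
    ((Lp.memLp v).mono_measure (Measure.restrict_mono Ioc_subset_Icc_self le_rfl))
  have hvf : v =ᵐ[volume.restrict (Icc (0 : ℝ) 1)] f := by
    have h1 : f =ᵐ[volume.restrict (Ioc (0 : ℝ) 1)] v := indicator_ae_eq_restrict measurableSet_Ioc
    rw [restrict_Ioc_eq_restrict_Icc] at h1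
    exact h1.symm
  have hf0 : ∀ r ≤ 0, f r = 0 := fun r hr =>
    indicator_of_notMem (fun hr' => hr'.1.not_ge hr) _
  have hε2 : 0 < ENNReal.ofReal (ε / 2) := by simpa using hε
  have htend : Filter.Tendsto (fun δ : ℝ => 2 * δ) (nhdsWithin 0 (Ici 0))
      (nhdsWithin 0 (Ici 0)) := by
    refine tendsto_nhdsWithin_iff.mpr ⟨?_, ?_⟩
    · have : Continuous fun δ : ℝ => 2 * δ := by fun_prop
      simpa using (this.tendsto 0).mono_left nhdsWithin_le_nhds
    · filter_upwards [self_mem_nhdsWithin] with δ hδ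
      have : (0 : ℝ) ≤ δ := hδ
      exact mem_Ici.mpr (by linarith)
  have hev := ((eventually_eLpNorm_loopControl_lt hub hε2).and
    (htend.eventually (eventually_eLpNorm_delayed_sub_lt hfL hε2))).filter_mono
      (nhdsWithin_mono (0 : ℝ) Ioi_subset_Ici_self)
  have hev' : ∀ᶠ δ in nhdsWithin (0 : ℝ) (Ioi 0), 0 < δ ∧ δ ≤ 1 / 4 :=
    Filter.inter_mem self_mem_nhdsWithin
      (nhdsWithin_le_nhds (Iic_mem_nhds (by norm_num : (0 : ℝ) < 1 / 4)))
  obtain ⟨δ, ⟨hloop, hdel⟩, hδ0, hδ4⟩ := (hev.and hev').exists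
  have hδ1 : 2 * δ ≤ 1 / 2 := by linarith
  have hlL := memLp_loopControl (δ := δ) hum hub
  have hdL := (memLp_delayed hfL (by linarith : 0 ≤ 2 * δ) hδ1).restrict (Icc (0 : ℝ) 1)
  set w : VelocitySpace d := MemLp.toLp _ (hlL.add hdL) with hw
  have hwae : w =ᵐ[volume.restrict (Icc (0 : ℝ) 1)] loopControl δ u + delayed (2 * δ) f :=
    MemLp.coeFn_toLp _
  set k : CameronMartin d := (CameronMartin.velocity d).symm w with hk
  have hkw : CameronMartin.velocity d k = w := (CameronMartin.velocity d).apply_symm_apply w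
  have hflow : ∀ m : CameronMartin d, skeletonFlow V 1 x m =
      solutionMap hσ hK x (CameronMartin.velocity d m) 1 := fun m => skeletonFlow_eq hσ hK x m 1
  refine ⟨k, ?_, ?_, fun p hp => ?_⟩
  · change skeletonFlow V 1 x k = x'
    rw [hflow, hkw, solutionMap_loop_one hσ hK x (MemLp.coeFn_toLp huL) hvf hf0 hδ0 hδ1 hwae,
      hv, ← hflow]
    exact hh
  · have hnorm : ‖h - k‖ = ‖w - v‖ := by
      rw [norm_sub_rev]
      change ‖CameronMartin.velocity d (k - h)‖ = _
      rw [map_sub, hkw]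
    have hdiff : (w - v : VelocitySpace d) =ᵐ[volume.restrict (Icc (0 : ℝ) 1)]
        loopControl δ u + (delayed (2 * δ) f - f) := by
      filter_upwards [Lp.coeFn_sub w v, hwae, hvf] with s h1 h2 h3
      rw [h1, Pi.sub_apply, h2, h3]
      simp only [Pi.add_apply, Pi.sub_apply]
      abel
    rw [hnorm, Lp.norm_def, eLpNorm_congr_ae hdiff]
    refine (ENNReal.toReal_lt_of_lt_ofReal ?_)
    refine (eLpNorm_add_le hlL.1 (hdL.sub (hfL.restrict _)).1 (by norm_num)).trans_lt ?_
    refine (ENNReal.add_lt_add hloop hdel).trans_le ?_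
    rw [← ENNReal.ofReal_add (by linarith) (by linarith), add_halves]
  -- On `(0, δ)` the new control is exactly the step control.
  · refine eq_zero_of_forall_inner_fderiv_solutionMap_eq_zero hV hH hK x w hA hδ0
      (by linarith) (fun j => ?_) (p := p) fun w' => ?_
    · have hae := hwae
      rw [Filter.EventuallyEq, ae_restrict_iff' measurableSet_Icc] at hae
      filter_upwards [hae] with s hs hsA hsδ
      rw [hs ⟨hsδ.1.le, by linarith [hsδ.2]⟩, Pi.add_apply, loopControl, if_pos hsδ.2.le, delayed,
        hf0 _ (mul_nonpos_of_nonneg_of_nonpos (inv_nonneg.mpr (by linarith))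
          (by linarith [hsδ.2])), smul_zero, add_zero]
      exact stepControl_of_mem hAd hsA
    · have h1 := hp ((CameronMartin.velocity d).symm w')
      rwa [fderiv_skeletonFlow_one_apply hV hK, hkw, LinearEquiv.apply_symm_apply] at h1

end Covariance

theorem mainTheorem4 (n d : ℕ)
    (V : Fin d → EuclideanSpace ℝ (Fin n) → EuclideanSpace ℝ (Fin n))
    (hA1 : SmoothBoundedDerivatives V) (hA2 : StrongHormander V)
    (x x' : EuclideanSpace ℝ (Fin n)) (h : CameronMartin d) (hh : h ∈ pathsBetween V x x')
    (ε : ℝ) (hε : 0 < ε) :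
    ∃ k ∈ pathsBetween V x x',
      ‖h - k‖ < ε ∧ (malliavinCovariance V x k).det ≠ 0 ∧ ExtendsToWiener k := by
  obtain ⟨k₀, hk₀, hnear, hnondeg⟩ := exists_nondegenerate_near hA1 hA2 hh hε
  have hdet := det_malliavinCovariance_ne_zero_of_forall hnondeg
  -- Closeness and nondegeneracy are open conditions, so they survive the passage to a nearby
  -- element of the dense subspace on the same level set.
  have hU : {k : CameronMartin d | ‖h - k‖ < ε ∧ (malliavinCovariance V x k).det ≠ 0} ∈ nhds k₀ :=
    Filter.inter_mem
      ((isOpen_lt (continuous_const.sub continuous_id).norm continuous_const).mem_nhds hnear)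
      ((isOpen_ne_fun (continuous_det_malliavinCovariance hA1 x) continuous_const).mem_nhds hdet)
  have hstrict := (contDiff_skeletonFlow_one hA1 x).hasStrictFDerivAt (x := k₀) one_ne_zero
  obtain ⟨k, hkU, hkS, hk⟩ := hstrict.exists_mem_dense_submodule_eq
    (surjective_of_forall_inner_eq_zero hnondeg) dense_extendsToWienerSubmodule hU
  exact ⟨k, hk.trans hk₀, hkU.1, hkU.2, hkS⟩
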